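/- Let $\Delta_n$ be the standard $n$-simplex, $\mathrm{Sd}^d$ the $d$-th barycentric subdivision, and for a finite simplicial complex $K$ let $f_i(K)$ be its number of $i$-simplices and $b_i(K)=\dim H_i(K;\mathbb{Z}/2\mathbb{Z})$. For $p\in\mathbb{N}$ and $\nu\in[0,1]$ set $$M_{p,\nu}(K)=(\nu^{p+1}+(1-\nu)^{p+1})\,b_p(K)+\nu(1-\nu)(\nu^p+(1-\nu)^p)\sum_{i=p+1}^{\dim K}(-1)^{i+1-p}\,(f_i(K)-b_i(K)).$$ *The number $\lambda_{p,\nu}(n)$.* Let $\mathcal{L}_d^{n,p}$ be the finite set of subcomplexes $L$ of $\mathrm{Sd}^d(\Delta_n)$ containing a family of simplices such that every simplex of $L$ is a face of a member of the family, and any two distinct members of the family, as well as any member and $\mathrm{Sd}^d(\partial\Delta_n)$, intersect in dimension less than $p-1$ (the empty set has dimension $-1$). Put $$\lambda^d_{p,\nu}(n)=\frac{1}{(n+1)!^d}\max_{L\in\mathcal{L}_d^{n,p}}M_{p,\nu}(L),\qquad \lambda_{p,\nu}(n)=\lim_{d\to+\infty}\lambda^d_{p,\nu}(n).$$ *The vector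 $h^n$.* For $s\in\{0,\dots,n+1\}$ let the tile $T_s^n$ be $\Delta_n$ deprived of $s$ of its facets $\sigma_1,\dots,\sigma_s$, and let $\mathrm{Sd}(T_s^n)=\mathrm{Sd}(\Delta_n)\setminus\bigcup_{i=1}^s\mathrm{Sd}(\sigma_i)$. A tiling of $\mathrm{Sd}(T_s^n)$ is a partition of it into tiles, each of which is an $n$-simplex of $\mathrm{Sd}(\Delta_n)$ deprived of some of its facets; its $h$-vector $(h_0,\dots,h_{n+1})$ counts the tiles with $0,\dots,n+1$ facets removed. Let $H_n$ be the $(n+2)\times(n+2)$ matrix whose rows, for $s=0,\dots,n+1$, are the $h$-vectors of tilings of $\mathrm{Sd}(T_s^n)$ such that a tile $T_0^n$ (resp. $T_{n+1}^n$) is used only for $s=0$ (resp. $s=n+1$), and then exactly once. Let $h^n=(h^n_0,\dots,h^n_{n+1})$ be the eigenvector of the transposed matrix $H_n^t$ for the eigenvalue $(n+1)!$ with $\sum_{s=0}^{n+1}h^n_s=1$. **Theorem.** Let $n\ge 2$, $p\in\{1,\dots,n-1\}$ and $\nu\in[0,1]$. The limit $\lambda_{p,\nu}(n)$ exists, the vector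 $h^n$ exists and is unique, and $$\lambda_{p,\nu}(n)\ \ge\ \frac{\nu(1-\nu)(\nu^p+(1-\nu)^p)}{(n+1)!}\Big[\Big(h_p^{n}+2^{p-1}\sum_{i=0}^{p-1}\frac{h^n_i}{2^i}\Big)\binom{n}{p+1}+\sum_{j=p+1}^{n+1}\Big(h_j^n+2^{j-2}\sum_{i=0}^{j-2}\frac{h^n_i}{2^i}\Big)\binom{n+p-j}{p+1}\Big].$$ -/

import Mathlib

open Filter Topology

namespace TilingPacking

/-- The full simplex spanned by a finite set `A` of vertices: its faces are the nonempty subsets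
of `A`. A finite simplicial complex is encoded by Mathlib's `PreAbstractSimplicialComplex`
(a downward closed family of nonempty finite sets; unlike `AbstractSimplicialComplex` it need not
contain every element of the ambient type as a vertex, so that subcomplexes live on the same
type). A `j`-dimensional simplex is a face with `j + 1` elements. -/
def fullSimplex {V : Type} (A : Finset V) : PreAbstractSimplicialComplex V where
  faces := {σ | σ.Nonempty ∧ σ ⊆ A}
  isRelLowerSet_faces := fun _ hσ =>
    ⟨hσ.1, fun _ hτσ hτ => ⟨hτ, le_trans hτσ hσ.2⟩⟩

/-- The boundary of the full simplex on `A`: its nonempty proper faces. -/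
def simplexBoundary {V : Type} (A : Finset V) : PreAbstractSimplicialComplex V where
  faces := {σ | σ.Nonempty ∧ σ ⊂ A}
  isRelLowerSet_faces := fun _ hσ =>
    ⟨hσ.1, fun _ hτσ hτ => ⟨hτ, lt_of_le_of_lt hτσ hσ.2⟩⟩

/-- The first barycentric subdivision: its vertices are the simplices of `K` (standing for their
barycenters), its simplices are the nonempty finite chains of simplices of `K`. -/
def sd {V : Type} (K : PreAbstractSimplicialComplex V) :
    PreAbstractSimplicialComplex (Finset V) where
  faces := {c | c.Nonempty ∧ (∀ σ ∈ c, σ ∈ K.faces) ∧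
    IsChain (fun σ τ : Finset V => σ ⊆ τ) (c : Set (Finset V))}
  isRelLowerSet_faces := fun _ hc =>
    ⟨hc.1, fun _ hbc hb => ⟨hb, fun σ hσ => hc.2.1 σ (hbc hσ),
      hc.2.2.mono (Finset.coe_subset.mpr hbc)⟩⟩

/-- The type containing the vertices of the `d`-th barycentric subdivision. -/
def SdVertex (V : Type) : ℕ → Type
  | 0 => V
  | d + 1 => Finset (SdVertex V d)

/-- The `d`-th barycentric subdivision. -/
def sdIter {V : Type} (K : PreAbstractSimplicialComplex V) :
    (d : ℕ) → PreAbstractSimplicialComplex (SdVertex V d)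
  | 0 => K
  | d + 1 => sd (sdIter K d)

/-- The standard `n`-simplex. -/
def stdSimplex (n : ℕ) : PreAbstractSimplicialComplex (Fin (n + 1)) :=
  fullSimplex Finset.univ

/-- The boundary of the standard `n`-simplex. -/
def stdBoundary (n : ℕ) : PreAbstractSimplicialComplex (Fin (n + 1)) :=
  simplexBoundary Finset.univ

/-- The dimension of an abstract simplex; the empty set has dimension `-1`. -/
def simplexDim {V : Type} (σ : Finset V) : ℤ := (σ.card : ℤ) - 1

/-- The number of `i`-dimensional simplices of `K`. -/
noncomputable def faceNumber {V : Type} (K : PreAbstractSimplicialComplex V) (i : ℕ) : ℕ :=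
  {σ | σ ∈ K.faces ∧ σ.card = i + 1}.ncard

/-- The dimension of a finite complex `K` (with value `0` for the empty complex). -/
noncomputable def complexDim {V : Type} (K : PreAbstractSimplicialComplex V) : ℕ :=
  sSup {i | ∃ σ ∈ K.faces, σ.card = i + 1}

open scoped Classical in
/-- The simplicial boundary operator with coefficients in `ℤ/2ℤ`: a simplex of positive dimension
is sent to the sum of its facets, and a vertex to `0`. -/
noncomputable def boundaryMap (V : Type) : (Finset V →₀ ZMod 2) →ₗ[ZMod 2] (Finset V →₀ ZMod 2) :=
  Finsupp.linearCombination (ZMod 2) fun σ : Finset V =>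
    if 2 ≤ σ.card then ∑ v ∈ σ, Finsupp.single (σ.erase v) (1 : ZMod 2) else 0

/-- The space of `i`-chains of `K` modulo `2`. -/
noncomputable def chains {V : Type} (K : PreAbstractSimplicialComplex V) (i : ℕ) :
    Submodule (ZMod 2) (Finset V →₀ ZMod 2) :=
  Finsupp.supported (ZMod 2) (ZMod 2) {σ | σ ∈ K.faces ∧ σ.card = i + 1}

/-- The space of `i`-cycles of `K` modulo `2`. -/
noncomputable def cycles {V : Type} (K : PreAbstractSimplicialComplex V) (i : ℕ) :
    Submodule (ZMod 2) (Finset V →₀ ZMod 2) :=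
  chains K i ⊓ LinearMap.ker (boundaryMap V)

/-- The space of `i`-boundaries of `K` modulo `2`. -/
noncomputable def boundaries {V : Type} (K : PreAbstractSimplicialComplex V) (i : ℕ) :
    Submodule (ZMod 2) (Finset V →₀ ZMod 2) :=
  (chains K (i + 1)).map (boundaryMap V)

/-- The dimension of the quotient space `Z / (Z ∩ B)`. -/
noncomputable def quotientDim {M : Type} [AddCommGroup M] [Module (ZMod 2) M]
    (Z B : Submodule (ZMod 2) M) : ℕ :=
  Module.finrank (ZMod 2) (Z ⧸ B.submoduleOf Z)

/-- The `i`-th Betti number of `K`: the dimension of `H_i(K; ℤ/2ℤ)`, cycles modulo boundaries. -/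
noncomputable def betti {V : Type} (K : PreAbstractSimplicialComplex V) (i : ℕ) : ℕ :=
  quotientDim (cycles K i) (boundaries K i)

/-- The number `M_{p,ν}(K)`. In the sum `i ≥ p + 1`, so the exponent `i + 1 - p` is not
truncated. -/
noncomputable def morseNumber {V : Type} (p : ℕ) (ν : ℝ) (K : PreAbstractSimplicialComplex V) :
    ℝ :=
  (ν ^ (p + 1) + (1 - ν) ^ (p + 1)) * (betti K p : ℝ) +
    ν * (1 - ν) * (ν ^ p + (1 - ν) ^ p) *
      ∑ i ∈ Finset.Icc (p + 1) (complexDim K),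
        (-1 : ℝ) ^ (i + 1 - p) * ((faceNumber K i : ℝ) - (betti K i : ℝ))

open scoped Classical in
/-- The set of subcomplexes `L` of `Sd^d(Δ_n)` which are unions of a family of simplices meeting
each other, and meeting the subdivided boundary `Sd^d(∂Δ_n)`, in dimension less than `p - 1`. -/
def packings (n p d : ℕ) : Set (PreAbstractSimplicialComplex (SdVertex (Fin (n + 1)) d)) :=
  {L | L ≤ sdIter (stdSimplex n) d ∧
    ∃ S : Set (Finset (SdVertex (Fin (n + 1)) d)), S ⊆ L.faces ∧
      (∀ τ ∈ L.faces, ∃ σ ∈ S, τ ⊆ σ) ∧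
      (∀ σ ∈ S, ∀ σ' ∈ S, σ ≠ σ' → simplexDim (σ ∩ σ') < (p : ℤ) - 1) ∧
      (∀ σ ∈ S, ∀ τ ∈ (sdIter (stdBoundary n) d).faces, τ ⊆ σ →
        simplexDim τ < (p : ℤ) - 1)}

theorem sdVertex_finite (V : Type) [Finite V] (d : ℕ) : Finite (SdVertex V d) := by
  induction d with
  | zero => exact ‹Finite V›
  | succ d ih =>
    have := ih
    exact inferInstanceAs (Finite (Finset (SdVertex V d)))

theorem packings_finite (n p d : ℕ) : (packings n p d).Finite := by
  have := sdVertex_finite (Fin (n + 1)) d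
  have : Finite (PreAbstractSimplicialComplex (SdVertex (Fin (n + 1)) d)) :=
    Finite.of_injective (fun K => K.faces) (fun _ _ h => PreAbstractSimplicialComplex.ext h)
  exact Set.toFinite _

theorem packings_nonempty (n p d : ℕ) : (packings n p d).Nonempty :=
  ⟨⊥, bot_le, ∅, Set.empty_subset _, fun _ h => h.elim, fun _ h => h.elim, fun _ h => h.elim⟩

/-- The number `λ^d_{p,ν}(n)`: the maximum of `M_{p,ν}` over the finite nonempty set of packings
(the supremum of a finite nonempty set of reals), divided by `(n+1)!^d`. -/
noncomputable def packingDensity (n p : ℕ) (ν : ℝ) (d : ℕ) : ℝ :=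
  (1 / ((n + 1).factorial : ℝ) ^ d) * sSup (morseNumber p ν '' packings n p d)

open scoped Classical in
/-- The set of open faces of the tile obtained from the simplex `σ` by removing the facets
opposite to the vertices in `R ⊆ σ`. -/
def tile {V : Type} (σ R : Finset V) : Set (Finset V) :=
  {τ | τ.Nonempty ∧ τ ⊆ σ ∧ ∀ v ∈ R, ¬ τ ⊆ σ.erase v}

/-- `T` is a tiling of the set `X` of open simplices by `n`-dimensional tiles: each element
`(σ, R)` of `T` encodes the tile `tile σ R`, where `σ` is an `n`-simplex and `R ⊆ σ`; the tiles
are pairwise disjoint and cover exactly `X`. -/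
def IsTiling {V : Type} (n : ℕ) (X : Set (Finset V)) (T : Finset (Finset V × Finset V)) : Prop :=
  (∀ t ∈ T, t.1.card = n + 1 ∧ t.2 ⊆ t.1) ∧
  (∀ t ∈ T, ∀ t' ∈ T, t ≠ t' → Disjoint (tile t.1 t.2) (tile t'.1 t'.2)) ∧
  (⋃ t ∈ T, tile t.1 t.2) = X

open scoped Classical in
/-- The `h`-vector of a tiling: `tilingH T s` is the number of tiles of `T` with exactly `s`
facets removed. -/
def tilingH {V : Type} (T : Finset (Finset V × Finset V)) (s : ℕ) : ℕ :=
  (T.filter fun t => t.2.card = s).card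

/-- The set of open simplices of `Sd(T_s^n)`, where `T_s^n` is `Δ_n` deprived of the `s` facets
opposite to the vertices `i < s`. -/
def sdTile (n s : ℕ) : Set (Finset (Finset (Fin (n + 1)))) :=
  (sd (stdSimplex n)).faces \
    ⋃ i ∈ {i : Fin (n + 1) | (i : ℕ) < s}, (sd (fullSimplex (Finset.univ.erase i))).faces

/-- `H` is the matrix `H_n`: its rows, indexed by `s = 0, …, n + 1`, are the `h`-vectors of
tilings of `Sd(T_s^n)` for which only `Sd(T_0^n)` contains a tile `T_0^n`, only `Sd(T_{n+1}^n)`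
contains a tile `T_{n+1}^n`, and each of these two contains exactly one such tile. -/
def IsTilingMatrix (n : ℕ) (H : Matrix (Fin (n + 2)) (Fin (n + 2)) ℕ) : Prop :=
  ∀ s : Fin (n + 2), ∃ T : Finset (Finset (Finset (Fin (n + 1))) × Finset (Finset (Fin (n + 1)))),
    IsTiling n (sdTile n s) T ∧
    tilingH T 0 = (if (s : ℕ) = 0 then 1 else 0) ∧
    tilingH T (n + 1) = (if (s : ℕ) = n + 1 then 1 else 0) ∧
    ∀ j : Fin (n + 2), H s j = tilingH T j

/-- `h` is the asymptotic `h`-vector `h^n`: the eigenvector of the transpose of `H_n` for the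
eigenvalue `(n+1)!`, normalized so that its entries sum to `1`. -/
def IsAsymptoticHVector (n : ℕ) (h : Fin (n + 2) → ℝ) : Prop :=
  ∃ H : Matrix (Fin (n + 2)) (Fin (n + 2)) ℕ, IsTilingMatrix n H ∧
    Matrix.mulVec (H.map (fun a : ℕ => (a : ℝ))).transpose h = ((n + 1).factorial : ℝ) • h ∧
    ∑ s, h s = 1

end TilingPacking

/-!
A face of dimension at least `p - 1` of a packing `L` lies in only one of the packed simplices. Hence
the homology of `L` vanishes in degrees at least `p` (`betti_eq_zero`), the face numbers add up, and
`M_{p,ν}(L) = ν(1-ν)(ν^p + (1-ν)^p) ∑ (dim σ).choose (p + 1)` over the packed simplices `σ`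
(`morseNumber_eq`). The problem becomes to maximize `weight` over the packings of the interior of
`Sd^d(Δ_n)`.

The complex `Sd^{d+1}(Δ_n)` is made of `(n+1)!` copies of `Sd^d(Δ_n)` meeting along their boundaries, so
a packing can be repeated in each copy (`IsPacking.exists_succ`) and the densities increase with `d`.
They are bounded, since the interior of `Sd^d(Δ_n)` is tiled by `(n+1)!^d` tiles
(`exists_isTiling_interiorFaces`). Thus the limit exists.

The set `Sd(T_s^n)` is tiled by tiles indexed by the permutations of `{0, …, n}`, through descents
(`isTiling_permTiling`). The face numbers determine the `h`-vector of a tiling with prescribed first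
entry (`IsTiling.tilingH_eq`), so `H_n` is the matrix of these tilings. Its rows sum to `(n+1)!`, and
the entries of its column of index `1` are positive (`tilingMatrix_pos`). Therefore `H_n / (n+1)!`
contracts the vectors of sum zero, so that `h^n` exists and is unique, and the distributions of the
tiles in the iterated tilings of the open simplex converge to `h^n` (`tendsto_stationary`).

For the lower bound, each tile of the interior of `Sd^d(Δ_n)` is subdivided once more, and `Sd(T_s^n)` is
packed by truncated flags indexed by the subsets of `{s, …, n}` (`exists_isPacking_sdTile`). Packings of
different tiles are compatible. Averaging the weights of the packings against `h^n` gives the bound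
(`le_of_tendsto_packingDensity`), and `sum_mul_tileWeight` is its closed form.
-/

namespace TilingPacking

/-! ### Packings of sets of open simplices -/

/-- `S` packs simplices into the set `X` of open simplices: only faces with fewer than `p` vertices
(dimension less than `p - 1`) of members of `S` may lie outside `X` or belong to two members. Members
with fewer than `p` vertices are excluded, since they contribute nothing to `weight p S`. -/
structure IsPacking {V : Type} (p : ℕ) (X : Set (Finset V)) (S : Finset (Finset V)) : Prop where
  le_card : ∀ σ ∈ S, p ≤ σ.card
  mem : ∀ σ ∈ S, ∀ β ⊆ σ, p ≤ β.card → β ∈ X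
  eq_of_subset : ∀ σ ∈ S, ∀ σ' ∈ S, ∀ β ⊆ σ, β ⊆ σ' → p ≤ β.card → σ = σ'

/-- The sum of `(dim σ).choose (p + 1)` over the simplices `σ` of the family. -/
def weight {V : Type} (p : ℕ) (S : Finset (Finset V)) : ℕ :=
  ∑ σ ∈ S, (σ.card - 1).choose (p + 1)

theorem IsPacking.map {V W : Type} {p : ℕ} {X : Set (Finset V)} {S : Finset (Finset V)}
    (h : IsPacking p X S) (e : V ↪ W) :
    IsPacking p (Finset.map e '' X) (S.map (Finset.mapEmbedding e).toEmbedding) where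
  le_card := by
    simp only [Finset.mem_map]
    rintro _ ⟨σ, hσ, rfl⟩
    simpa using h.le_card σ hσ
  mem := by
    simp only [Finset.mem_map]
    rintro _ ⟨σ, hσ, rfl⟩ β hβ hp
    obtain ⟨β, hβ', rfl⟩ := Finset.subset_map_iff.1 hβ
    exact ⟨β, h.mem σ hσ β hβ' (by simpa using hp), rfl⟩
  eq_of_subset := by
    simp only [Finset.mem_map]
    rintro _ ⟨σ, hσ, rfl⟩ _ ⟨σ', hσ', rfl⟩ β hβ hβ' hp
    obtain ⟨β, hb, rfl⟩ := Finset.subset_map_iff.1 hβ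
    rw [h.eq_of_subset σ hσ σ' hσ' β hb (by simpa using hβ') (by simpa using hp)]

theorem weight_map {V W : Type} (p : ℕ) (S : Finset (Finset V)) (e : V ↪ W) :
    weight p (S.map (Finset.mapEmbedding e).toEmbedding) = weight p S := by
  simp [weight]

/-- Packings of disjoint regions of `X` form together a packing of `X`: a common face of members from
two regions with at least `p` vertices would lie in both regions. -/
theorem IsPacking.exists_biUnion {V ι : Type} {p : ℕ} {X : Set (Finset V)} (I : Finset ι)
    (Y : ι → Set (Finset V)) (S : ι → Finset (Finset V)) (hYX : ∀ i ∈ I, Y i ⊆ X)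
    (hY : ∀ i ∈ I, ∀ j ∈ I, i ≠ j → Disjoint (Y i) (Y j))
    (hS : ∀ i ∈ I, IsPacking p (Y i) (S i)) :
    ∃ U, IsPacking p X U ∧ weight p U = ∑ i ∈ I, weight p (S i) := by
  classical
  have key : ∀ i ∈ I, ∀ j ∈ I, ∀ σ ∈ S i, ∀ σ' ∈ S j, ∀ β ⊆ σ, β ⊆ σ' → p ≤ β.card → i = j := by
    intro i hi j hj σ hσ σ' hσ' β hβ hβ' hp
    by_contra hij
    exact Set.disjoint_left.1 (hY i hi j hj hij) ((hS i hi).mem σ hσ β hβ hp)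
      ((hS j hj).mem σ' hσ' β hβ' hp)
  refine ⟨I.biUnion S, ⟨?_, ?_, ?_⟩, ?_⟩
  · simp only [Finset.mem_biUnion]
    rintro σ ⟨i, hi, hσ⟩
    exact (hS i hi).le_card σ hσ
  · simp only [Finset.mem_biUnion]
    rintro σ ⟨i, hi, hσ⟩ β hβ hp
    exact hYX i hi ((hS i hi).mem σ hσ β hβ hp)
  · simp only [Finset.mem_biUnion]
    rintro σ ⟨i, hi, hσ⟩ σ' ⟨j, hj, hσ'⟩ β hβ hβ' hp
    obtain rfl := key i hi j hj σ hσ σ' hσ' β hβ hβ' hp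
    exact (hS i hi).eq_of_subset σ hσ σ' hσ' β hβ hβ' hp
  · refine Finset.sum_biUnion ?_
    intro i hi j hj hij
    refine Finset.disjoint_left.2 fun σ hσ hσ' => hij ?_
    exact key i hi j hj σ hσ σ hσ' σ subset_rfl subset_rfl ((hS i hi).le_card σ hσ)

theorem alternating_sum_choose_aux (a p k : ℕ) :
    ∑ i ∈ Finset.Icc (p + 1) (p + k), (-1 : ℝ) ^ (i + 1 - p) * ((a + 1).choose (i + 1) : ℝ) =
      (a.choose (p + 1) : ℝ) - (-1) ^ k * (a.choose (p + k + 1) : ℝ) := by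
  induction k with
  | zero => simp
  | succ k ih =>
    rw [← add_assoc, Finset.sum_Icc_succ_top (by omega), ih,
      show p + k + 1 + 1 - p = k + 2 by omega, Nat.choose_succ_succ a (p + k + 1)]
    push_cast
    ring

theorem alternating_sum_choose {a D : ℕ} (p : ℕ) (h : a ≤ D) :
    ∑ i ∈ Finset.Icc (p + 1) D, (-1 : ℝ) ^ (i + 1 - p) * ((a + 1).choose (i + 1) : ℝ) =
      (a.choose (p + 1) : ℝ) := by
  rcases le_total p D with hD | hD
  · obtain ⟨k, rfl⟩ := Nat.exists_eq_add_of_le hD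
    rw [alternating_sum_choose_aux, Nat.choose_eq_zero_of_lt (show a < p + k + 1 by omega)]
    simp
  · rw [Finset.Icc_eq_empty (by omega), Nat.choose_eq_zero_of_lt (by omega)]
    simp

/-! ### The number `M_{p,ν}` of a packed complex -/

section Morse

variable {V : Type} {p : ℕ} {K : PreAbstractSimplicialComplex V} {S : Finset (Finset V)}

theorem faceNumber_eq_sum (hSK : ∀ σ ∈ S, σ ∈ K.faces)
    (hKS : ∀ τ ∈ K.faces, p ≤ τ.card → ∃ σ ∈ S, τ ⊆ σ)
    (hS : ∀ σ ∈ S, ∀ σ' ∈ S, ∀ β ⊆ σ, β ⊆ σ' → p ≤ β.card → σ = σ') {i : ℕ} (hi : p ≤ i) :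
    faceNumber K i = ∑ σ ∈ S, σ.card.choose (i + 1) := by
  classical
  have : {σ | σ ∈ K.faces ∧ σ.card = i + 1} =
      (S.biUnion fun σ => σ.powersetCard (i + 1) : Finset (Finset V)) := by
    ext τ
    simp only [Set.mem_ofPred_eq, Finset.coe_biUnion, Set.mem_iUnion, Finset.mem_coe,
      Finset.mem_powersetCard, exists_prop]
    constructor
    · rintro ⟨hτ, hc⟩
      obtain ⟨σ, hσ, h⟩ := hKS τ hτ (by omega)
      exact ⟨σ, hσ, h, hc⟩
    · rintro ⟨σ, hσ, h, hc⟩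
      exact ⟨(K.isRelLowerSet_faces (hSK σ hσ)).2 h (Finset.card_pos.1 (by omega)), hc⟩
  rw [faceNumber, this, Set.ncard_coe_finset, Finset.card_biUnion]
  · simp
  · intro σ hσ σ' hσ' hne
    refine Finset.disjoint_left.2 fun τ h h' => hne ?_
    rw [Finset.mem_powersetCard] at h h'
    exact hS σ hσ σ' hσ' τ h.1 h'.1 (by omega)

open scoped Classical in
/-- The cone operator on chains modulo `2` with a variable apex: a simplex `τ` is sent to
`insert (a τ) τ`, and to `0` if it contains its apex `a τ`. -/
noncomputable def coneMap (a : Finset V → V) : (Finset V →₀ ZMod 2) →ₗ[ZMod 2] (Finset V →₀ ZMod 2) :=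
  Finsupp.linearCombination (ZMod 2) fun τ : Finset V =>
    if a τ ∈ τ then 0 else Finsupp.single (insert (a τ) τ) (1 : ZMod 2)

/-- The cone operator is a contracting homotopy at `τ` as soon as the facets of `τ` have the same
apex as `τ`. -/
theorem boundaryMap_coneMap (a : Finset V → V) {τ : Finset V} (h2 : 2 ≤ τ.card)
    (ha : ∀ τ' : Finset V, τ' ⊆ τ → τ.card ≤ τ'.card + 1 → a τ' = a τ) :
    boundaryMap V (coneMap a (Finsupp.single τ 1)) + coneMap a (boundaryMap V (Finsupp.single τ 1)) =
      Finsupp.single τ 1 := by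
  classical
  have hb : ∀ ρ : Finset V, 2 ≤ ρ.card → boundaryMap V (Finsupp.single ρ 1) =
      ∑ v ∈ ρ, Finsupp.single (ρ.erase v) (1 : ZMod 2) := by
    intro ρ hρ
    simp only [boundaryMap, Finsupp.linearCombination_single, one_smul, if_pos hρ]
  have hc : ∀ ρ : Finset V, coneMap a (Finsupp.single ρ 1) =
      if a ρ ∈ ρ then 0 else Finsupp.single (insert (a ρ) ρ) (1 : ZMod 2) := by
    intro ρ
    simp only [coneMap, Finsupp.linearCombination_single, one_smul]
  have hae : ∀ v ∈ τ, a (τ.erase v) = a τ := fun v hv =>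
    ha _ (Finset.erase_subset _ _) (by rw [Finset.card_erase_of_mem hv]; omega)
  rw [hb τ h2, map_sum, hc τ]
  by_cases h : a τ ∈ τ
  · rw [if_pos h, map_zero, zero_add, Finset.sum_eq_single (a τ)]
    · rw [hc, hae _ h, if_neg (Finset.notMem_erase _ _), Finset.insert_erase h]
    · intro v hv hne
      rw [hc, hae _ hv, if_pos (Finset.mem_erase.2 ⟨hne.symm, h⟩)]
    · exact fun h' => absurd h h'
  · rw [if_neg h, hb _ (by rw [Finset.card_insert_of_notMem h]; omega), Finset.sum_insert h,
      Finset.erase_insert h, add_assoc, ← Finset.sum_add_distrib, Finset.sum_eq_zero, add_zero]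
    intro v hv
    have hne : a τ ≠ v := fun h' => h (h' ▸ hv)
    rw [hc, hae _ hv, if_neg (fun h' => h (Finset.mem_of_mem_erase h')),
      Finset.erase_insert_of_ne hne]
    -- the cone over a facet occurs in both composites, hence cancels modulo `2`
    rw [← Finsupp.single_add, CharTwo.add_self_eq_zero, Finsupp.single_zero]

/-- Faces with at least `p` vertices lie in a single packed simplex `σ`, so cones with apex a vertex
of `σ` kill the homology in degrees at least `p`. The facets of a face of dimension at least `p` still
have `p` vertices, so they have the same apex. -/
theorem betti_eq_zero (hp : 1 ≤ p) (hSK : ∀ σ ∈ S, σ ∈ K.faces)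
    (hKS : ∀ τ ∈ K.faces, p ≤ τ.card → ∃ σ ∈ S, τ ⊆ σ)
    (hS : ∀ σ ∈ S, ∀ σ' ∈ S, ∀ β ⊆ σ, β ⊆ σ' → p ≤ β.card → σ = σ') {i : ℕ} (hi : p ≤ i) :
    betti K i = 0 := by
  suffices h : cycles K i ≤ boundaries K i by
    have : (boundaries K i).submoduleOf (cycles K i) = ⊤ := Submodule.submoduleOf_eq_top.2 h
    rw [betti, quotientDim, this]
    exact Module.finrank_zero_of_subsingleton
  classical
  rintro z ⟨hz, hz0⟩
  rw [SetLike.mem_coe, LinearMap.mem_ker] at hz0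
  rw [SetLike.mem_coe, chains, Finsupp.supported_eq_span_single] at hz
  rcases isEmpty_or_nonempty V with hV | hV
  · have hempty : {σ | σ ∈ K.faces ∧ σ.card = i + 1} = ∅ := by
      refine Set.eq_empty_of_forall_notMem fun τ hτ => ?_
      obtain ⟨v, -⟩ := (K.isRelLowerSet_faces hτ.1).1
      exact hV.elim v
    rw [hempty, Set.image_empty, Submodule.span_empty, Submodule.mem_bot] at hz
    rw [hz]
    exact zero_mem _
  choose! w hw using fun σ (hσ : σ ∈ S) => (K.isRelLowerSet_faces (hSK σ hσ)).1
  obtain ⟨a, ha⟩ : ∃ a : Finset V → V, ∀ σ ∈ S, ∀ τ ⊆ σ, p ≤ τ.card → a τ = w σ := by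
    refine ⟨fun τ => if h : ∃ σ ∈ S, τ ⊆ σ then w h.choose else hV.some, fun σ hσ τ hτ hpτ => ?_⟩
    have h : ∃ σ ∈ S, τ ⊆ σ := ⟨σ, hσ, hτ⟩
    simp only [dif_pos h]
    rw [hS _ h.choose_spec.1 σ hσ τ h.choose_spec.2 hτ hpτ]
  refine ⟨coneMap a z, ?_, ?_⟩
  · suffices h : Submodule.span (ZMod 2) ((fun τ => Finsupp.single τ (1 : ZMod 2)) ''
        {σ | σ ∈ K.faces ∧ σ.card = i + 1}) ≤ (chains K (i + 1)).comap (coneMap a) from h hz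
    rw [Submodule.span_le]
    rintro _ ⟨τ, ⟨hτ, hτi⟩, rfl⟩
    obtain ⟨σ, hσ, hτσ⟩ := hKS τ hτ (by omega)
    simp only [coneMap, SetLike.mem_coe, Submodule.mem_comap, Finsupp.linearCombination_single,
      one_smul]
    split_ifs with h
    · exact zero_mem _
    · refine Finsupp.single_mem_supported _ _ ⟨?_, ?_⟩
      · refine (K.isRelLowerSet_faces (hSK σ hσ)).2 ?_ (Finset.insert_nonempty _ _)
        refine Finset.insert_subset ?_ hτσ
        rw [ha σ hσ τ hτσ (by omega)]
        exact hw σ hσ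
      · rw [Finset.card_insert_of_notMem h, hτi]
  · have h : Set.EqOn (boundaryMap V ∘ₗ coneMap a + coneMap a ∘ₗ boundaryMap V)
        (LinearMap.id : (Finset V →₀ ZMod 2) →ₗ[ZMod 2] _)
        ((fun τ => Finsupp.single τ (1 : ZMod 2)) '' {σ | σ ∈ K.faces ∧ σ.card = i + 1}) := by
      rintro _ ⟨τ, ⟨hτ, hτi⟩, rfl⟩
      obtain ⟨σ, hσ, hτσ⟩ := hKS τ hτ (by omega)
      refine boundaryMap_coneMap a (by omega) fun τ' hτ' hcard => ?_
      rw [ha σ hσ τ hτσ (by omega), ha σ hσ τ' (hτ'.trans hτσ) (by omega)]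
    have hz' := LinearMap.eqOn_span h hz
    simpa [hz0] using hz'

/-- The Betti numbers in `M_{p,ν}` vanish and the alternating sum of the face numbers of a simplex in
dimensions above `p` is a single binomial coefficient. -/
theorem morseNumber_eq [Finite V] (hp : 1 ≤ p) (ν : ℝ) (hSK : ∀ σ ∈ S, σ ∈ K.faces)
    (hKS : ∀ τ ∈ K.faces, p ≤ τ.card → ∃ σ ∈ S, τ ⊆ σ)
    (hS : ∀ σ ∈ S, ∀ σ' ∈ S, ∀ β ⊆ σ, β ⊆ σ' → p ≤ β.card → σ = σ') :
    morseNumber p ν K = ν * (1 - ν) * (ν ^ p + (1 - ν) ^ p) * (weight p S : ℝ) := by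
  have hle : ∀ σ ∈ S, σ.card - 1 ≤ complexDim K := by
    intro σ hσ
    have hpos := Finset.card_pos.2 (K.isRelLowerSet_faces (hSK σ hσ)).1
    refine le_csSup ⟨Nat.card V, ?_⟩ ⟨σ, hSK σ hσ, by omega⟩
    rintro i ⟨τ, -, hτ⟩
    have := Fintype.ofFinite V
    have := Finset.card_le_univ τ
    rw [Nat.card_eq_fintype_card]
    omega
  rw [morseNumber, betti_eq_zero hp hSK hKS hS le_rfl, Nat.cast_zero, mul_zero, zero_add]
  congr 1
  have : ∀ i ∈ Finset.Icc (p + 1) (complexDim K),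
      (-1 : ℝ) ^ (i + 1 - p) * ((faceNumber K i : ℝ) - (betti K i : ℝ)) =
        ∑ σ ∈ S, (-1 : ℝ) ^ (i + 1 - p) * ((σ.card - 1 + 1).choose (i + 1) : ℝ) := by
    intro i hi
    rw [Finset.mem_Icc] at hi
    rw [betti_eq_zero hp hSK hKS hS (by omega), faceNumber_eq_sum hSK hKS hS (by omega),
      Nat.cast_zero, sub_zero, Nat.cast_sum, Finset.mul_sum]
    refine Finset.sum_congr rfl fun σ hσ => ?_
    have hpos := Finset.card_pos.2 (K.isRelLowerSet_faces (hSK σ hσ)).1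
    rw [Nat.sub_add_cancel hpos]
  rw [Finset.sum_congr rfl this, Finset.sum_comm, weight, Nat.cast_sum]
  exact Finset.sum_congr rfl fun σ hσ => alternating_sum_choose p (hle σ hσ)

end Morse

/-- The open simplices of `Sd^d(Δ_n)` in the interior of `Δ_n`. -/
def interiorFaces (n d : ℕ) : Set (Finset (SdVertex (Fin (n + 1)) d)) :=
  (sdIter (stdSimplex n) d).faces \ (sdIter (stdBoundary n) d).faces

theorem exists_isPacking_of_mem_packings {n p d : ℕ} (hp : 1 ≤ p) (ν : ℝ)
    {L : PreAbstractSimplicialComplex (SdVertex (Fin (n + 1)) d)} (hL : L ∈ packings n p d) :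
    ∃ S, IsPacking p (interiorFaces n d) S ∧
      morseNumber p ν L = ν * (1 - ν) * (ν ^ p + (1 - ν) ^ p) * (weight p S : ℝ) := by
  classical
  have := sdVertex_finite (Fin (n + 1)) d
  obtain ⟨hLK, S, hSL, hLS, hS, hbd⟩ := hL
  have huniq : ∀ σ ∈ S, ∀ σ' ∈ S, ∀ β ⊆ σ, β ⊆ σ' → p ≤ β.card → σ = σ' := by
    intro σ hσ σ' hσ' β hβ hβ' hpβ
    by_contra hne
    have h1 := hS σ hσ σ' hσ' hne
    have h2 : β.card ≤ (σ ∩ σ').card := Finset.card_le_card (Finset.subset_inter hβ hβ')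
    simp only [simplexDim] at h1
    have h3 : (β.card : ℤ) ≤ ((σ ∩ σ').card : ℤ) := by exact_mod_cast h2
    have h4 : (p : ℤ) ≤ β.card := by exact_mod_cast hpβ
    omega
  let S' : Finset (Finset (SdVertex (Fin (n + 1)) d)) :=
    (Set.toFinite {σ | σ ∈ S ∧ p ≤ σ.card}).toFinset
  have hmem : ∀ σ, σ ∈ S' ↔ σ ∈ S ∧ p ≤ σ.card := fun σ => by simp [S']
  refine ⟨S', ⟨fun σ hσ => ((hmem σ).1 hσ).2, ?_, ?_⟩, ?_⟩
  · intro σ hσ β hβ hpβ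
    have hσS := ((hmem σ).1 hσ).1
    refine ⟨hLK ((L.isRelLowerSet_faces (hSL hσS)).2 hβ (Finset.card_pos.1 (by omega))),
      fun h => ?_⟩
    have := hbd σ hσS β h hβ
    simp only [simplexDim] at this
    omega
  · exact fun σ hσ σ' hσ' => huniq σ ((hmem σ).1 hσ).1 σ' ((hmem σ').1 hσ').1
  · refine morseNumber_eq hp ν (fun σ hσ => hSL ((hmem σ).1 hσ).1) ?_
      fun σ hσ σ' hσ' => huniq σ ((hmem σ).1 hσ).1 σ' ((hmem σ').1 hσ').1
    intro τ hτ hpτ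
    obtain ⟨σ, hσ, hτσ⟩ := hLS τ hτ
    exact ⟨σ, (hmem σ).2 ⟨hσ, hpτ.trans (Finset.card_le_card hτσ)⟩, hτσ⟩

theorem exists_mem_packings_of_isPacking {n p d : ℕ} (hp : 1 ≤ p) (ν : ℝ)
    {S : Finset (Finset (SdVertex (Fin (n + 1)) d))} (hS : IsPacking p (interiorFaces n d) S) :
    ∃ L ∈ packings n p d,
      morseNumber p ν L = ν * (1 - ν) * (ν ^ p + (1 - ν) ^ p) * (weight p S : ℝ) := by
  classical
  have := sdVertex_finite (Fin (n + 1)) d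
  have hface : ∀ σ ∈ S, σ ∈ (sdIter (stdSimplex n) d).faces := fun σ hσ =>
    (hS.mem σ hσ σ subset_rfl (hS.le_card σ hσ)).1
  let L : PreAbstractSimplicialComplex (SdVertex (Fin (n + 1)) d) :=
    { faces := {τ | τ.Nonempty ∧ ∃ σ ∈ S, τ ⊆ σ}
      isRelLowerSet_faces := fun τ hτ => ⟨hτ.1, fun ρ hρ hne =>
        ⟨hne, hτ.2.imp fun σ h => ⟨h.1, le_trans hρ h.2⟩⟩⟩ }
  have hSL : ∀ σ ∈ S, σ ∈ L.faces := fun σ hσ =>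
    ⟨((sdIter (stdSimplex n) d).isRelLowerSet_faces (hface σ hσ)).1, σ, hσ, subset_rfl⟩
  refine ⟨L, ⟨?_, (S : Set _), fun σ hσ => hSL σ hσ, fun τ hτ => hτ.2, ?_, ?_⟩, ?_⟩
  · rintro τ ⟨hne, σ, hσ, hτσ⟩
    exact ((sdIter (stdSimplex n) d).isRelLowerSet_faces (hface σ hσ)).2 hτσ hne
  · intro σ hσ σ' hσ' hne
    by_contra hcon
    refine hne (hS.eq_of_subset σ hσ σ' hσ' _ Finset.inter_subset_left Finset.inter_subset_right ?_)
    simp only [simplexDim] at hcon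
    omega
  · intro σ hσ τ hτ hτσ
    by_contra hcon
    simp only [simplexDim] at hcon
    exact (hS.mem σ hσ τ hτσ (by omega)).2 hτ
  · exact morseNumber_eq hp ν hSL (fun τ hτ _ => hτ.2) hS.eq_of_subset

theorem mem_sdTile {n s : ℕ} {c : Finset (Finset (Fin (n + 1)))} :
    c ∈ sdTile n s ↔ c.Nonempty ∧ (∀ A ∈ c, A.Nonempty) ∧
      IsChain (fun σ τ : Finset (Fin (n + 1)) => σ ⊆ τ) (c : Set (Finset (Fin (n + 1)))) ∧
      ∀ i : Fin (n + 1), i.val < s → ∃ A ∈ c, i ∈ A := by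
  simp only [sdTile, sd, stdSimplex, fullSimplex, Set.mem_sdiff, Set.mem_iUnion, Set.mem_ofPred_eq,
    Finset.subset_univ, and_true, exists_prop, not_exists, not_and]
  constructor
  · rintro ⟨⟨h1, h2, h3⟩, h4⟩
    refine ⟨h1, h2, h3, fun i hi => ?_⟩
    by_contra! hcon
    refine h4 i hi h1 (fun A hA => ⟨h2 A hA, fun x hx => ?_⟩) h3
    exact Finset.mem_erase.2 ⟨fun h => hcon A hA (h ▸ hx), Finset.mem_univ _⟩
  · rintro ⟨h1, h2, h3, h4⟩
    refine ⟨⟨h1, h2, h3⟩, fun i hi _ h _ => ?_⟩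
    obtain ⟨A, hA, hiA⟩ := h4 i hi
    exact Finset.notMem_erase i _ ((h A hA).2 hiA)

/-! ### Packing simplices in a subdivided tile

The gaps of a set `X ⊆ {0, …, n}` are the non-members of `X` below some member. For each set `V` of
values at least `s`, `gapFlag V` is a maximal flag whose member `gapFlag V x` has the gaps
`V ∩ {y | y < x}`. The gaps of a common member of the flags of two sets `V ≠ V'` are thus an initial
segment of both, so either no common member has the gaps `V`, or none has the gaps `V'`. In the first
case, the common members have an index `x ≤ max V` in the flag of `V`. Truncating each flag at
`x ≥ max V + 2 - p` leaves at most `p - 1` such indices, which bounds the intersections. -/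

section Packing

variable {n : ℕ}

/-- The members of the maximal flag attached to `V`. As `x` runs up through `V` they are the
complements of the initial segments of `V`, from the full set down; for `x ∉ V` they are the initial
segments of the complement of `V`. -/
def gapFlag (V : Finset ℕ) (x : Fin (n + 1)) : Finset (Fin (n + 1)) :=
  Finset.univ.filter fun y =>
    if x.val ∈ V then y.val ∉ V ∨ x ≤ y else y.val ∉ V ∧ y ≤ x

theorem mem_gapFlag_of_mem {V : Finset ℕ} {x y : Fin (n + 1)} (hx : x.val ∈ V) :
    y ∈ gapFlag V x ↔ y.val ∉ V ∨ x ≤ y := by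
  simp [gapFlag, hx]

theorem mem_gapFlag_of_notMem {V : Finset ℕ} {x y : Fin (n + 1)} (hx : x.val ∉ V) :
    y ∈ gapFlag V x ↔ y.val ∉ V ∧ y ≤ x := by
  simp [gapFlag, hx]

theorem self_mem_gapFlag (V : Finset ℕ) (x : Fin (n + 1)) : x ∈ gapFlag V x := by
  by_cases hx : x.val ∈ V
  · exact (mem_gapFlag_of_mem hx).2 (Or.inr le_rfl)
  · exact (mem_gapFlag_of_notMem hx).2 ⟨hx, le_rfl⟩

/-- The gaps of `gapFlag V x` are the elements of `V` below `x`. -/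
theorem gap_gapFlag (V : Finset ℕ) (x y : Fin (n + 1)) :
    (y ∉ gapFlag V x ∧ ∃ z ∈ gapFlag V x, y < z) ↔ y.val ∈ V ∧ y < x := by
  by_cases hx : x.val ∈ V
  · simp only [mem_gapFlag_of_mem hx, not_or, not_not, not_le]
    exact ⟨fun h => h.1, fun h => ⟨h, x, Or.inr le_rfl, h.2⟩⟩
  · simp only [mem_gapFlag_of_notMem hx, not_and_or, not_not, not_le]
    constructor
    · rintro ⟨h | h, z, hz, hyz⟩
      · exact ⟨h, lt_of_lt_of_le hyz hz.2⟩
      · exact absurd (h.trans hyz) (not_lt.2 hz.2)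
    · rintro ⟨h, hyx⟩
      exact ⟨Or.inl h, x, ⟨hx, le_rfl⟩, hyx⟩

theorem gapFlag_injective (V : Finset ℕ) : Function.Injective (gapFlag (n := n) V) := by
  have key : ∀ x x' : Fin (n + 1), gapFlag V x = gapFlag V x' → x < x' → False := by
    intro x x' h hlt
    by_cases hx : x.val ∈ V
    · have := (gap_gapFlag V x' x).2 ⟨hx, hlt⟩
      rw [← h] at this
      exact this.1 (self_mem_gapFlag V x)
    · by_cases hx' : x'.val ∈ V
      · have := self_mem_gapFlag V x'
        rw [← h, mem_gapFlag_of_notMem hx] at this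
        exact this.1 hx'
      · have := self_mem_gapFlag V x'
        rw [← h, mem_gapFlag_of_notMem hx] at this
        exact absurd hlt (not_lt.2 this.2)
  intro x x' h
  rcases lt_trichotomy x x' with h' | h' | h'
  · exact (key x x' h h').elim
  · exact h'
  · exact (key x' x h.symm h').elim

theorem gapFlag_total (V : Finset ℕ) (x x' : Fin (n + 1)) :
    gapFlag V x ⊆ gapFlag V x' ∨ gapFlag V x' ⊆ gapFlag V x := by
  wlog hle : x ≤ x' generalizing x x'
  · exact (this x' x (le_of_not_ge hle)).symm
  by_cases hx : x.val ∈ V <;> by_cases hx' : x'.val ∈ V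
  · refine Or.inr fun y hy => ?_
    rw [mem_gapFlag_of_mem hx'] at hy
    exact (mem_gapFlag_of_mem hx).2 (hy.imp_right hle.trans)
  · refine Or.inr fun y hy => ?_
    rw [mem_gapFlag_of_notMem hx'] at hy
    exact (mem_gapFlag_of_mem hx).2 (Or.inl hy.1)
  · refine Or.inl fun y hy => ?_
    rw [mem_gapFlag_of_notMem hx] at hy
    exact (mem_gapFlag_of_mem hx').2 (Or.inl hy.1)
  · refine Or.inl fun y hy => ?_
    rw [mem_gapFlag_of_notMem hx] at hy
    exact (mem_gapFlag_of_notMem hx').2 ⟨hy.1, hy.2.trans hle⟩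

/-- The maximum of `V` plus `2`, or `s` if `V` is empty (when all elements of `V` are at least `s`). -/
def gapBound (s : ℕ) (V : Finset ℕ) : ℕ := max s (V.sup (· + 2))

/-- The flag of `V`, truncated to the indices `x ≥ gapBound s V - p`. -/
def gapChain (n p s : ℕ) (V : Finset ℕ) : Finset (Finset (Fin (n + 1))) :=
  (Finset.univ.filter fun x : Fin (n + 1) => gapBound s V ≤ x.val + p).image (gapFlag V)

theorem card_filter_le_add (n p b : ℕ) :
    (Finset.univ.filter fun x : Fin (n + 1) => b ≤ x.val + p).card = min (n + 1) (n + 1 + p - b) := by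
  have h : (Finset.univ.filter fun x : Fin (n + 1) => b ≤ x.val + p).map Fin.valEmbedding =
      Finset.Ico (b - p) (n + 1) := by
    ext y
    simp only [Finset.mem_map, Finset.mem_filter, Finset.mem_univ, true_and,
      Fin.valEmbedding_apply, Finset.mem_Ico]
    constructor
    · rintro ⟨x, hx, rfl⟩
      omega
    · rintro ⟨h1, h2⟩
      exact ⟨⟨y, h2⟩, by simp only []; omega, rfl⟩
  rw [← Finset.card_map Fin.valEmbedding, h, Nat.card_Ico]
  omega

theorem card_gapChain_sub_one (n p s : ℕ) (V : Finset ℕ) :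
    (gapChain n p s V).card - 1 = min n (n + p - gapBound s V) := by
  rw [gapChain, Finset.card_image_of_injective _ (gapFlag_injective V), card_filter_le_add]
  omega

/-- The indices in the interval `[b - p, b - 2]` are fewer than `p`. -/
theorem card_lt_of_subset_image_gapFlag {p b : ℕ} (hp : 1 ≤ p) {V : Finset ℕ}
    {β : Finset (Finset (Fin (n + 1)))}
    (hβ : ∀ X ∈ β, ∃ x, b ≤ x.val + p ∧ x.val + 2 ≤ b ∧ gapFlag V x = X) : β.card < p := by
  have h1 : β ⊆ (Finset.univ.filter fun x : Fin (n + 1) => b ≤ x.val + p ∧ x.val + 2 ≤ b).image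
      (gapFlag V) := by
    intro X hX
    obtain ⟨x, h1, h2, h3⟩ := hβ X hX
    exact Finset.mem_image.2 ⟨x, by simp [h1, h2], h3⟩
  have h2 : ((Finset.univ.filter fun x : Fin (n + 1) => b ≤ x.val + p ∧ x.val + 2 ≤ b).map
      Fin.valEmbedding) ⊆ Finset.Ico (b - p) (b - 1) := by
    intro y hy
    simp only [Finset.mem_map, Finset.mem_filter, Finset.mem_univ, true_and] at hy
    obtain ⟨x, hx, rfl⟩ := hy
    simp only [Fin.valEmbedding_apply, Finset.mem_Ico]
    omega
  have h3 := Finset.card_le_card h2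
  rw [Finset.card_map, Nat.card_Ico] at h3
  have h4 := (Finset.card_le_card h1).trans Finset.card_image_le
  omega

/-- Only the members with an index below `s - 1` can fail to contain `{0, …, s - 1}`, and fewer than
`p` of them survive the truncation. -/
theorem gapChain_mem_sdTile {p s : ℕ} (hp : 1 ≤ p) {V : Finset ℕ} (hV : ∀ v ∈ V, s ≤ v)
    {β : Finset (Finset (Fin (n + 1)))} (hβ : β ⊆ gapChain n p s V) (hc : p ≤ β.card) :
    β ∈ sdTile n s := by
  have hβ' : ∀ X ∈ β, ∃ x : Fin (n + 1), gapBound s V ≤ x.val + p ∧ gapFlag V x = X := by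
    intro X hX
    simpa [gapChain] using hβ hX
  refine mem_sdTile.2 ⟨Finset.card_pos.1 (by omega), fun X hX => ?_, fun X hX Y hY _ => ?_,
    fun i hi => ?_⟩
  · obtain ⟨x, -, rfl⟩ := hβ' X hX
    exact ⟨x, self_mem_gapFlag V x⟩
  · obtain ⟨x, -, rfl⟩ := hβ' X hX
    obtain ⟨y, -, rfl⟩ := hβ' Y hY
    exact gapFlag_total V x y
  · by_contra! hcon
    refine absurd hc (not_le.2 (card_lt_of_subset_image_gapFlag (b := s) (V := V) hp
      fun X hX => ?_))
    obtain ⟨x, hx, rfl⟩ := hβ' X hX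
    refine ⟨x, (le_max_left _ _).trans hx, ?_, rfl⟩
    by_contra hlt
    have hiV : i.val ∉ V := fun h => absurd (hV _ h) (not_le.2 hi)
    refine hcon _ hX ?_
    by_cases hxV : x.val ∈ V
    · exact (mem_gapFlag_of_mem hxV).2 (Or.inl hiV)
    · exact (mem_gapFlag_of_notMem hxV).2 ⟨hiV, Fin.le_def.2 (by omega)⟩

/-- Fewer than `p` members of the truncated flag of `V` are indexed by some `x ≤ max V`; any other
member has `V` as its set of gaps. -/
theorem exists_gapFlag_mem {p s : ℕ} (hp : 1 ≤ p) {V : Finset ℕ}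
    {β : Finset (Finset (Fin (n + 1)))} (hβ : β ⊆ gapChain n p s V) (hc : p ≤ β.card) :
    ∃ x : Fin (n + 1), gapFlag V x ∈ β ∧ ∀ v ∈ V, v < x.val := by
  have hβ' : ∀ X ∈ β, ∃ x : Fin (n + 1), gapBound s V ≤ x.val + p ∧ gapFlag V x = X := by
    intro X hX
    simpa [gapChain] using hβ hX
  by_contra! hcon
  refine absurd hc (not_le.2 (card_lt_of_subset_image_gapFlag (b := V.sup (· + 2)) (V := V) hp
      fun X hX => ?_))
  obtain ⟨x, hx, rfl⟩ := hβ' X hX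
  refine ⟨x, (le_max_right _ _).trans hx, ?_, rfl⟩
  obtain ⟨v, hv, hxv⟩ := hcon x hX
  exact le_trans (by omega) (Finset.le_sup (f := (· + 2)) hv)

theorem eq_of_subset_gapChain {p s : ℕ} (hp : 1 ≤ p) {V V' : Finset ℕ}
    (hV : V ⊆ Finset.Ico s (n + 1)) (hV' : V' ⊆ Finset.Ico s (n + 1))
    {β : Finset (Finset (Fin (n + 1)))} (hβ : β ⊆ gapChain n p s V) (hβ' : β ⊆ gapChain n p s V')
    (hc : p ≤ β.card) : V = V' := by
  have key : ∀ W W' : Finset ℕ, W ⊆ Finset.Ico s (n + 1) → β ⊆ gapChain n p s W →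
      β ⊆ gapChain n p s W' → W ⊆ W' := by
    intro W W' hW hβ hβ' v hv
    obtain ⟨x, hx, hlt⟩ := exists_gapFlag_mem hp hβ hc
    have hx' := hβ' hx
    simp only [gapChain, Finset.mem_image] at hx'
    obtain ⟨x', -, hxx'⟩ := hx'
    have h := (gap_gapFlag W x ⟨v, (Finset.mem_Ico.1 (hW hv)).2⟩).2 ⟨hv, hlt v hv⟩
    rw [← hxx', gap_gapFlag] at h
    exact h.1
  exact (key V V' hV hβ hβ').antisymm (key V' V hV' hβ' hβ)

/-- There are `2 ^ (v - s)` sets `V` with maximum `v` and all elements at least `s`. -/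
theorem sum_powerset_gapBound (s k : ℕ) (hsk : s ≤ k) (f : ℕ → ℕ) :
    ∑ V ∈ (Finset.Ico s k).powerset, f (gapBound s V) =
      f s + ∑ v ∈ Finset.Ico s k, 2 ^ (v - s) * f (v + 2) := by
  induction k, hsk using Nat.le_induction with
  | base => simp [gapBound]
  | succ k hk ih =>
    rw [← Finset.insert_Ico_right_eq_Ico_add_one hk, Finset.sum_powerset_insert (by simp), ih,
      Finset.sum_insert (by simp)]
    have : ∀ V ∈ (Finset.Ico s k).powerset, f (gapBound s (insert k V)) = f (k + 2) := by
      intro V hV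
      rw [Finset.mem_powerset] at hV
      have : V.sup (· + 2) ≤ k + 2 := Finset.sup_le fun v hv => by
        have := Finset.mem_Ico.1 (hV hv)
        omega
      rw [gapBound, Finset.sup_insert, sup_eq_left.2 this, max_eq_right (by omega)]
    rw [Finset.sum_congr rfl this, Finset.sum_const, Finset.card_powerset, Nat.card_Ico]
    simp only [smul_eq_mul]
    ring

theorem exists_isPacking_sdTile {p s : ℕ} (hp : 1 ≤ p) (hs : s ≤ n + 1) :
    ∃ S, IsPacking p (sdTile n s) S ∧ weight p S =
      (min n (n + p - s)).choose (p + 1) +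
        ∑ v ∈ Finset.Ico s (n + 1), 2 ^ (v - s) * (min n (n + p - (v + 2))).choose (p + 1) := by
  let I := (Finset.Ico s (n + 1)).powerset.filter fun V => p ≤ (gapChain n p s V).card
  have hI : ∀ V, V ∈ I ↔ V ⊆ Finset.Ico s (n + 1) ∧ p ≤ (gapChain n p s V).card := by
    intro V
    simp [I]
  have hinj : ∀ V ∈ I, ∀ V' ∈ I, ∀ β ⊆ gapChain n p s V, β ⊆ gapChain n p s V' → p ≤ β.card →
      V = V' := fun V hV V' hV' β hβ hβ' hc =>
    eq_of_subset_gapChain hp ((hI V).1 hV).1 ((hI V').1 hV').1 hβ hβ' hc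
  refine ⟨I.image (gapChain n p s), ⟨?_, ?_, ?_⟩, ?_⟩
  · simp only [Finset.mem_image]
    rintro _ ⟨V, hV, rfl⟩
    exact ((hI V).1 hV).2
  · simp only [Finset.mem_image]
    rintro _ ⟨V, hV, rfl⟩ β hβ hc
    exact gapChain_mem_sdTile hp (fun v hv => (Finset.mem_Ico.1 (((hI V).1 hV).1 hv)).1) hβ hc
  · simp only [Finset.mem_image]
    rintro _ ⟨V, hV, rfl⟩ _ ⟨V', hV', rfl⟩ β hβ hβ' hc
    rw [hinj V hV V' hV' β hβ hβ' hc]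
  · rw [weight, Finset.sum_image, ← sum_powerset_gapBound s (n + 1) hs fun b =>
      (min n (n + p - b)).choose (p + 1)]
    · rw [Finset.sum_filter_of_ne]
      · exact Finset.sum_congr rfl fun V _ => by rw [card_gapChain_sub_one]
      · intro V _ h
        by_contra hlt
        exact h (Nat.choose_eq_zero_of_lt (by omega))
    · intro V hV V' hV' h
      exact hinj V hV V' hV' _ subset_rfl h.subset ((hI V).1 hV).2

end Packing

theorem mem_tile {V : Type} {σ R τ : Finset V} :
    τ ∈ tile σ R ↔ τ.Nonempty ∧ τ ⊆ σ ∧ R ⊆ τ := by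
  classical
  simp only [tile, Set.mem_ofPred_eq]
  refine and_congr_right fun _ => and_congr_right fun hτ => forall_congr' fun v =>
    imp_congr_right fun _ => ?_
  rw [not_iff_comm]
  exact ⟨fun h x hx => Finset.mem_erase.2 ⟨fun hxv => h (hxv ▸ hx), hτ hx⟩,
    fun h hv => Finset.notMem_erase v σ (by convert h hv)⟩

/-! ### Tilings of a subdivided tile by descents

The `n`-simplices of `Sd(Δ_n)` are the flags of prefixes of permutations `π`. From the flag of `π` the
facets opposite to the prefixes ending at an ascent are removed, the final position counting as an
ascent if its value is less than `s`. A chain `c` then lies in the tile of exactly one permutation, the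
one that lists the blocks of `c` in order and the elements of each block in decreasing order. -/

section PermTiling

variable {n : ℕ}

/-- The set of the values of `π` at the positions up to `k`. -/
def prefixSet (π : Equiv.Perm (Fin (n + 1))) (k : Fin (n + 1)) : Finset (Fin (n + 1)) :=
  (Finset.Iic k).map π.toEmbedding

theorem mem_prefixSet {π : Equiv.Perm (Fin (n + 1))} {k x : Fin (n + 1)} :
    x ∈ prefixSet π k ↔ π.symm x ≤ k := by
  simp only [prefixSet, Finset.mem_map, Finset.mem_Iic]
  constructor
  · rintro ⟨i, hi, rfl⟩
    simpa using hi
  · exact fun h => ⟨π.symm x, h, by simp⟩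

theorem apply_mem_prefixSet {π : Equiv.Perm (Fin (n + 1))} {k i : Fin (n + 1)} :
    π i ∈ prefixSet π k ↔ i ≤ k := by
  rw [mem_prefixSet, Equiv.symm_apply_apply]

theorem prefixSet_injective (π : Equiv.Perm (Fin (n + 1))) :
    Function.Injective (prefixSet π) := by
  intro k l h
  refine le_antisymm ?_ ?_
  · rw [← apply_mem_prefixSet (π := π), ← h, apply_mem_prefixSet]
  · rw [← apply_mem_prefixSet (π := π), h, apply_mem_prefixSet]

/-- The maximal flag of the prefixes of `π`. -/
def permFlag (π : Equiv.Perm (Fin (n + 1))) : Finset (Finset (Fin (n + 1))) :=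
  Finset.univ.image (prefixSet π)

/-- The value of `π` at the position after `k`. The word of `π` is continued by `s`, so that the last
position is an ascent exactly when its value is less than `s`. -/
def nextValue (s : ℕ) (π : Equiv.Perm (Fin (n + 1))) (k : Fin (n + 1)) : ℕ :=
  if h : k.val + 1 < n + 1 then (π ⟨k.val + 1, h⟩).val else s

/-- The ascents of the word of `π` continued by `s`. -/
def ascents (s : ℕ) (π : Equiv.Perm (Fin (n + 1))) : Finset (Fin (n + 1)) :=
  Finset.univ.filter fun k => (π k).val < nextValue s π k

/-- The vertices of the flag of `π` whose opposite facets are removed from its tile. -/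
def restriction (s : ℕ) (π : Equiv.Perm (Fin (n + 1))) : Finset (Finset (Fin (n + 1))) :=
  (ascents s π).image (prefixSet π)

/-- Sorting by this key sorts first by blocks of the chain `c`, then decreasingly within blocks. -/
def sortKey (c : Finset (Finset (Fin (n + 1)))) (x : Fin (n + 1)) : ℕ :=
  (c.filter fun A => x ∉ A).card * (n + 1) + (n - x.val)

theorem mem_restriction {s : ℕ} {π : Equiv.Perm (Fin (n + 1))} {k : Fin (n + 1)} :
    prefixSet π k ∈ restriction s π ↔ (π k).val < nextValue s π k := by
  simp [restriction, ascents, (prefixSet_injective π).eq_iff]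

theorem eq_sort_of_strictMono {f : Fin (n + 1) → ℕ} {π : Equiv.Perm (Fin (n + 1))}
    (h : StrictMono (f ∘ π)) : π = Tuple.sort f :=
  Tuple.eq_sort_iff.2 ⟨h.monotone, fun _ _ hij heq => absurd heq (h hij).ne⟩

theorem sortKey_injective (c : Finset (Finset (Fin (n + 1)))) :
    Function.Injective (sortKey c) := by
  intro x y h
  simp only [sortKey] at h
  have h2 := congrArg (· % (n + 1)) h
  simp only [Nat.mul_add_mod_of_lt (show n - x.val < n + 1 by omega), Nat.mul_add_mod_self_right,
    Nat.mod_eq_of_lt (show n - y.val < n + 1 by omega)] at h2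
  exact Fin.ext (by omega)

theorem sortKey_lt_of_card_lt {c : Finset (Finset (Fin (n + 1)))} {x y : Fin (n + 1)}
    (h : (c.filter fun A => x ∉ A).card < (c.filter fun A => y ∉ A).card) :
    sortKey c x < sortKey c y := by
  have h1 := Nat.mul_le_mul_right (n + 1) (Nat.succ_le_of_lt h)
  rw [Nat.succ_mul] at h1
  simp only [sortKey]
  omega

/-- A chain in the tile of `π` determines `π`, as the permutation sorting `sortKey c`. -/
theorem strictMono_sortKey {s : ℕ} {π : Equiv.Perm (Fin (n + 1))}
    {c : Finset (Finset (Fin (n + 1)))} (hc : c ⊆ permFlag π) (hR : restriction s π ⊆ c) :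
    StrictMono (sortKey c ∘ π) := by
  refine Fin.strictMono_iff_lt_succ.2 fun i => ?_
  have hsub : (c.filter fun A => π i.castSucc ∉ A) ⊆ c.filter fun A => π i.succ ∉ A := by
    intro A hA
    rw [Finset.mem_filter] at hA ⊢
    refine ⟨hA.1, ?_⟩
    obtain ⟨k, -, rfl⟩ := Finset.mem_image.1 (hc hA.1)
    have h := hA.2
    rw [apply_mem_prefixSet] at h ⊢
    exact fun h' => h (i.castSucc_lt_succ.le.trans h')
  by_cases hmem : prefixSet π i.castSucc ∈ c
  · refine sortKey_lt_of_card_lt (Finset.card_lt_card ⟨hsub, fun h => ?_⟩)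
    have h1 := h (Finset.mem_filter.2 ⟨hmem, by
      rw [apply_mem_prefixSet]
      exact not_le.2 i.castSucc_lt_succ⟩)
    rw [Finset.mem_filter, apply_mem_prefixSet] at h1
    exact h1.2 le_rfl
  · have h1 : ¬ prefixSet π i.castSucc ∈ restriction s π := fun h => hmem (hR h)
    rw [mem_restriction, nextValue, dif_pos (by simp)] at h1
    have h2 : π i.succ ≠ π i.castSucc := fun h => i.castSucc_lt_succ.ne' (π.injective h)
    have h3 : (π i.succ).val ≠ (π i.castSucc).val := fun h => h2 (Fin.ext h)
    have h4 : (⟨i.castSucc.val + 1, by simp⟩ : Fin (n + 1)) = i.succ := rfl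
    rw [h4] at h1
    have h5 := Nat.mul_le_mul_right (n + 1) (Finset.card_le_card hsub)
    simp only [Function.comp_apply, sortKey]
    omega

/-- A chain of `Sd(T_s^n)` lies in the tile of the permutation sorting `sortKey c`. -/
theorem subset_permFlag_sort {s : ℕ} {c : Finset (Finset (Fin (n + 1)))} (hc : c ∈ sdTile n s) :
    c ⊆ permFlag (Tuple.sort (sortKey c)) ∧ restriction s (Tuple.sort (sortKey c)) ⊆ c := by
  obtain ⟨-, hne, hchain, hs⟩ := mem_sdTile.1 hc
  set π := Tuple.sort (sortKey c) with hπ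
  have hmono : StrictMono (sortKey c ∘ π) :=
    (Tuple.monotone_sort _).strictMono_of_injective ((sortKey_injective c).comp π.injective)
  have hflag : ∀ A ∈ c, ∀ i j : Fin (n + 1), π i ∈ A → π j ∉ A → i < j := by
    intro A hA i j hi hj
    rw [← hmono.lt_iff_lt]
    refine sortKey_lt_of_card_lt (Finset.card_lt_card ⟨fun B hB => ?_, fun h => ?_⟩)
    · rw [Finset.mem_filter] at hB ⊢
      refine ⟨hB.1, fun hjB => ?_⟩
      rcases hchain.total hA hB.1 with h | h
      · exact hB.2 (h hi)
      · exact hj (h hjB)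
    · exact (Finset.mem_filter.1 (h (Finset.mem_filter.2 ⟨hA, hj⟩))).2 hi
  have hlow : ∀ A ∈ c, ∀ k : Fin (n + 1), π k ∈ A →
      (∀ j, k < j → π j ∉ A) → A = prefixSet π k := by
    intro A hA k hk hj
    ext x
    obtain ⟨i, rfl⟩ := π.surjective x
    rw [apply_mem_prefixSet]
    constructor
    · intro hi
      by_contra hlt
      exact hj i (not_le.1 hlt) hi
    · intro hik
      by_contra hi
      exact absurd (hflag A hA k i hk hi) (not_lt.2 hik)
  constructor
  · intro A hA
    have hne' : (Finset.univ.filter fun k => π k ∈ A).Nonempty := by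
      obtain ⟨x, hx⟩ := hne A hA
      exact ⟨π.symm x, by simpa using hx⟩
    refine Finset.mem_image.2 ⟨_, Finset.mem_univ _, (hlow A hA
      ((Finset.univ.filter fun k => π k ∈ A).max' hne') ?_ fun j hj hjA => ?_).symm⟩
    · exact (Finset.mem_filter.1 (Finset.max'_mem _ hne')).2
    · exact absurd (Finset.le_max' _ j (by simpa using hjA)) (not_le.2 hj)
  · intro B hB
    obtain ⟨k, hk, rfl⟩ := Finset.mem_image.1 hB
    rw [ascents, Finset.mem_filter, nextValue] at hk
    have hk := hk.2
    split_ifs at hk with h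
    · have hlt : k < ⟨k.val + 1, h⟩ := Fin.lt_def.2 (by simp)
      have hkey := hmono hlt
      obtain ⟨A, hA, hA1, hA2⟩ : ∃ A ∈ c, π k ∈ A ∧ π ⟨k.val + 1, h⟩ ∉ A := by
        by_contra! hcon
        have hsub : (c.filter fun A => π ⟨k.val + 1, h⟩ ∉ A) ⊆ c.filter fun A => π k ∉ A := by
          intro A hA
          rw [Finset.mem_filter] at hA ⊢
          exact ⟨hA.1, fun h' => hA.2 (hcon A hA.1 h')⟩
        have h5 := Nat.mul_le_mul_right (n + 1) (Finset.card_le_card hsub)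
        simp only [Function.comp_apply, sortKey] at hkey
        omega
      rw [← hlow A hA k hA1 fun j hj hjA => hA2 ?_]
      · exact hA
      · by_contra hcon
        exact absurd (hflag A hA j _ hjA hcon) (not_lt.2 (Fin.le_def.2 (Nat.succ_le_of_lt hj)))
    · obtain ⟨A, hA, hA1⟩ := hs (π k) hk
      rw [← hlow A hA k hA1 fun j hj hjA => ?_]
      · exact hA
      · have := Fin.lt_def.1 hj
        omega

theorem mem_sdTile_of_subset_permFlag {s : ℕ} {π : Equiv.Perm (Fin (n + 1))}
    {c : Finset (Finset (Fin (n + 1)))} (hne : c.Nonempty) (hc : c ⊆ permFlag π)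
    (hR : restriction s π ⊆ c) : c ∈ sdTile n s := by
  refine mem_sdTile.2 ⟨hne, fun A hA => ?_, fun A hA B hB _ => ?_, fun i hi => ?_⟩
  · obtain ⟨k, -, rfl⟩ := Finset.mem_image.1 (hc hA)
    exact ⟨π k, apply_mem_prefixSet.2 le_rfl⟩
  · obtain ⟨k, -, rfl⟩ := Finset.mem_image.1 (hc hA)
    obtain ⟨l, -, rfl⟩ := Finset.mem_image.1 (hc hB)
    rcases le_total k l with h | h
    · exact Or.inl fun x hx => mem_prefixSet.2 ((mem_prefixSet.1 hx).trans h)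
    · exact Or.inr fun x hx => mem_prefixSet.2 ((mem_prefixSet.1 hx).trans h)
    -- the values of `π` beyond the largest member of `c` decrease and end above `s`
  · by_contra! hcon
    have key : ∀ m : ℕ, ∀ k : Fin (n + 1), k.val + m = n → (π k).val < s →
        ∃ l, k ≤ l ∧ prefixSet π l ∈ c := by
      intro m
      induction m with
      | zero =>
        intro k hk hks
        refine ⟨k, le_rfl, hR (mem_restriction.2 ?_)⟩
        rw [nextValue, dif_neg (by omega)]
        exact hks
      | succ m ih =>
        intro k hk hks
        by_cases hasc : (π k).val < nextValue s π k
        · exact ⟨k, le_rfl, hR (mem_restriction.2 hasc)⟩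
        · rw [nextValue, dif_pos (by omega)] at hasc
          obtain ⟨l, hl, hlc⟩ := ih ⟨k.val + 1, by omega⟩ (by simp only []; omega) (by omega)
          exact ⟨l, (Fin.le_def.2 (by simp)).trans hl, hlc⟩
    obtain ⟨l, hl, hlc⟩ := key (n - (π.symm i).val) (π.symm i) (by omega) (by simpa using hi)
    exact hcon _ hlc (mem_prefixSet.2 hl)

/-- The tiling of `Sd(T_s^n)` indexed by the permutations. -/
def permTiling (n s : ℕ) :
    Finset (Finset (Finset (Fin (n + 1))) × Finset (Finset (Fin (n + 1)))) :=
  Finset.univ.image fun π : Equiv.Perm (Fin (n + 1)) => (permFlag π, restriction s π)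

theorem restriction_subset (s : ℕ) (π : Equiv.Perm (Fin (n + 1))) :
    restriction s π ⊆ permFlag π :=
  Finset.image_subset_image (Finset.subset_univ _)

theorem card_permFlag (π : Equiv.Perm (Fin (n + 1))) : (permFlag π).card = n + 1 := by
  rw [permFlag, Finset.card_image_of_injective _ (prefixSet_injective π), Finset.card_univ,
    Fintype.card_fin]

/-- The full flag of `π` lies in the tile of `π`, so it determines `π`. -/
theorem permFlag_injective : Function.Injective (permFlag (n := n)) := by
  intro π π' h
  have h1 := eq_sort_of_strictMono (strictMono_sortKey (subset_refl _) (restriction_subset 0 π))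
  have h2 := eq_sort_of_strictMono (strictMono_sortKey (subset_refl _) (restriction_subset 0 π'))
  rw [h1, h2, h]

theorem isTiling_permTiling (n s : ℕ) : IsTiling n (sdTile n s) (permTiling n s) := by
  refine ⟨?_, ?_, ?_⟩
  · simp only [permTiling, Finset.mem_image, Finset.mem_univ, true_and]
    rintro _ ⟨π, rfl⟩
    exact ⟨card_permFlag π, restriction_subset s π⟩
  · simp only [permTiling, Finset.mem_image, Finset.mem_univ, true_and]
    rintro _ ⟨π, rfl⟩ _ ⟨π', rfl⟩ hne
    refine Set.disjoint_left.2 fun c hc hc' => hne ?_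
    obtain ⟨-, h1, h2⟩ := mem_tile.1 hc
    obtain ⟨-, h1', h2'⟩ := mem_tile.1 hc'
    rw [eq_sort_of_strictMono (strictMono_sortKey h1 h2),
      eq_sort_of_strictMono (strictMono_sortKey h1' h2')]
  · ext c
    simp only [Set.mem_iUnion, exists_prop]
    constructor
    · rintro ⟨t, ht, hc⟩
      obtain ⟨π, -, rfl⟩ := Finset.mem_image.1 ht
      obtain ⟨h0, h1, h2⟩ := mem_tile.1 hc
      exact mem_sdTile_of_subset_permFlag h0 h1 h2
    · intro hc
      obtain ⟨h1, h2⟩ := subset_permFlag_sort hc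
      exact ⟨_, Finset.mem_image_of_mem _ (Finset.mem_univ (Tuple.sort (sortKey c))),
        mem_tile.2 ⟨(mem_sdTile.1 hc).1, h1, h2⟩⟩

theorem card_permTiling (n s : ℕ) : (permTiling n s).card = (n + 1).factorial := by
  rw [permTiling, Finset.card_image_of_injective, Finset.card_univ, Fintype.card_perm,
    Fintype.card_fin]
  exact fun π π' h => permFlag_injective (congrArg Prod.fst h)

theorem tilingH_permTiling (n s j : ℕ) : tilingH (permTiling n s) j =
    (Finset.univ.filter fun π : Equiv.Perm (Fin (n + 1)) => (ascents s π).card = j).card := by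
  classical
  rw [tilingH, permTiling, Finset.filter_image, Finset.card_image_of_injective]
  · congr 1
    ext π
    rw [Finset.mem_filter, Finset.mem_filter]
    change _ ∧ (restriction s π).card = j ↔ _
    rw [restriction, Finset.card_image_of_injective _ (prefixSet_injective π)]
  · exact fun π π' h => permFlag_injective (congrArg Prod.fst h)

theorem card_ascents_eq_zero_iff (s : ℕ) (π : Equiv.Perm (Fin (n + 1))) :
    (ascents s π).card = 0 ↔ s = 0 ∧ π = Fin.revPerm := by
  rw [Finset.card_eq_zero, ascents, Finset.filter_eq_empty_iff]
  constructor
  · intro h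
    have hanti : StrictAnti π := by
      refine Fin.strictAnti_iff_succ_lt.2 fun i => ?_
      have h1 := h (Finset.mem_univ i.castSucc)
      rw [nextValue, dif_pos (by simp)] at h1
      have h2 : π i.succ ≠ π i.castSucc := fun h => i.castSucc_lt_succ.ne' (π.injective h)
      exact lt_of_le_of_ne (not_lt.1 h1) h2
    have hrev : ∀ i, π i = i.rev := by
      have hm : StrictMono (π ∘ Fin.rev) := hanti.comp Fin.rev_strictAnti
      have := (StrictMono.range_inj hm strictMono_id).1 (by
        rw [Set.range_id, (π.surjective.comp Fin.rev_surjective).range_eq])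
      intro i
      have := congrFun this i.rev
      simpa using this
    have hlast := h (Finset.mem_univ (Fin.last n))
    rw [nextValue, dif_neg (by simp), hrev] at hlast
    simp only [Fin.rev_last, Fin.val_zero, not_lt, Nat.le_zero] at hlast
    exact ⟨hlast, Equiv.ext hrev⟩
  · rintro ⟨rfl, rfl⟩ k -
    rw [nextValue]
    split_ifs with h
    · simp only [Fin.revPerm_apply, Fin.val_rev]
      omega
    · simp

theorem card_ascents_eq_add_one_iff {s : ℕ} (hs : s ≤ n + 1) (π : Equiv.Perm (Fin (n + 1))) :
    (ascents s π).card = n + 1 ↔ s = n + 1 ∧ π = 1 := by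
  have : (ascents s π).card = n + 1 ↔ ascents s π = Finset.univ := by
    rw [← Finset.card_eq_iff_eq_univ, Fintype.card_fin]
  rw [this, ascents, Finset.filter_eq_self]
  constructor
  · intro h
    have hmono : StrictMono π := by
      refine Fin.strictMono_iff_lt_succ.2 fun i => ?_
      have h1 := h i.castSucc (Finset.mem_univ i.castSucc)
      rw [nextValue, dif_pos (by simp)] at h1
      exact h1
    have hid := (StrictMono.range_inj hmono strictMono_id).1 (by
        rw [Set.range_id, π.surjective.range_eq])
    have hlast := h (Fin.last n) (Finset.mem_univ _)
    rw [nextValue, dif_neg (by simp), hid] at hlast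
    simp only [id, Fin.val_last] at hlast
    exact ⟨by omega, Equiv.ext fun i => congrFun hid i⟩
  · rintro ⟨rfl, rfl⟩ k -
    rw [nextValue]
    split_ifs with h
    · simp
    · simp only [Equiv.Perm.coe_one, id]
      omega

theorem tilingH_permTiling_zero (n s : ℕ) :
    tilingH (permTiling n s) 0 = if s = 0 then 1 else 0 := by
  simp only [tilingH_permTiling, card_ascents_eq_zero_iff]
  split_ifs with h <;> simp [h, Finset.filter_eq']

theorem tilingH_permTiling_last {n s : ℕ} (hs : s ≤ n + 1) :
    tilingH (permTiling n s) (n + 1) = if s = n + 1 then 1 else 0 := by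
  simp only [tilingH_permTiling, card_ascents_eq_add_one_iff hs]
  split_ifs with h <;> simp [h, Finset.filter_eq']

end PermTiling

/-! ### The matrix `H_n` -/

section HVector

theorem sum_tiling {V M : Type} [AddCommMonoid M] {n : ℕ} {X : Set (Finset V)}
    {T : Finset (Finset V × Finset V)} (hT : IsTiling n X T) (f : ℕ → M) :
    ∑ t ∈ T, f t.2.card = ∑ r ∈ Finset.range (n + 2), tilingH T r • f r := by
  classical
  have hmaps : ∀ t ∈ T, t.2.card ∈ Finset.range (n + 2) := by
    intro t ht
    have h := hT.1 t ht
    have := Finset.card_le_card h.2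
    rw [Finset.mem_range]
    omega
  rw [← Finset.sum_fiberwise_of_maps_to hmaps]
  refine Finset.sum_congr rfl fun r _ => ?_
  rw [Finset.sum_congr rfl (g := fun _ => f r) fun t ht => by rw [(Finset.mem_filter.1 ht).2],
    Finset.sum_const, tilingH]

/-- The number of faces with `k` vertices of a tile with `R.card` facets removed. -/
theorem card_filter_powersetCard {V : Type} [DecidableEq V] {σ R : Finset V} (hR : R ⊆ σ) (k : ℕ) :
    ((σ.powersetCard k).filter fun τ => R ⊆ τ).card =
      if R.card ≤ k then (σ.card - R.card).choose (k - R.card) else 0 := by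
  split_ifs with h
  · rw [← Finset.card_sdiff_of_subset hR, ← Finset.card_powersetCard]
    refine Finset.card_bij' (fun τ _ => τ \ R) (fun ρ _ => ρ ∪ R) ?_ ?_ ?_ ?_
    · intro τ hτ
      simp only [Finset.mem_filter, Finset.mem_powersetCard] at hτ ⊢
      exact ⟨Finset.sdiff_subset_sdiff hτ.1.1 subset_rfl, by
        rw [Finset.card_sdiff_of_subset hτ.2, hτ.1.2]⟩
    · intro ρ hρ
      simp only [Finset.mem_filter, Finset.mem_powersetCard] at hρ ⊢
      have hd : Disjoint ρ R := Finset.disjoint_of_subset_left hρ.1 Finset.sdiff_disjoint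
      exact ⟨⟨Finset.union_subset (hρ.1.trans Finset.sdiff_subset) hR, by
        rw [Finset.card_union_of_disjoint hd, hρ.2]; omega⟩, Finset.subset_union_right⟩
    · intro τ hτ
      exact Finset.sdiff_union_of_subset (Finset.mem_filter.1 hτ).2
    · intro ρ hρ
      have hd : Disjoint ρ R := Finset.disjoint_of_subset_left
        (Finset.mem_powersetCard.1 hρ).1 Finset.sdiff_disjoint
      exact Finset.union_sdiff_cancel_right hd
  · rw [Finset.card_eq_zero, Finset.filter_eq_empty_iff]
    intro τ hτ hRτ
    have := Finset.card_le_card hRτ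
    rw [(Finset.mem_powersetCard.1 hτ).2] at this
    exact h this

theorem IsTiling.ncard_faces {V : Type} {n : ℕ} {X : Set (Finset V)}
    {T : Finset (Finset V × Finset V)} (hT : IsTiling n X T) {k : ℕ} (hk : 1 ≤ k) :
    {τ | τ ∈ X ∧ τ.card = k}.ncard = ∑ r ∈ Finset.range (n + 2),
      tilingH T r * if r ≤ k then (n + 1 - r).choose (k - r) else 0 := by
  classical
  have h1 : {τ | τ ∈ X ∧ τ.card = k} =
      (T.biUnion fun t => (t.1.powersetCard k).filter fun τ => t.2 ⊆ τ : Finset (Finset V)) := by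
    ext τ
    simp only [← hT.2.2, Set.mem_ofPred_eq, Set.mem_iUnion, exists_prop, Finset.coe_biUnion,
      Finset.mem_coe, Finset.mem_filter, Finset.mem_powersetCard, mem_tile]
    constructor
    · rintro ⟨⟨t, ht, -, h1, h2⟩, hc⟩
      exact ⟨t, ht, ⟨h1, hc⟩, h2⟩
    · rintro ⟨t, ht, ⟨h1, hc⟩, h2⟩
      exact ⟨⟨t, ht, Finset.card_pos.1 (by omega), h1, h2⟩, hc⟩
  rw [h1, Set.ncard_coe_finset, Finset.card_biUnion]
  · have hsum := sum_tiling hT fun r => if r ≤ k then (n + 1 - r).choose (k - r) else 0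
    simp only [smul_eq_mul] at hsum
    rw [← hsum]
    refine Finset.sum_congr rfl fun t ht => ?_
    rw [card_filter_powersetCard (hT.1 t ht).2, (hT.1 t ht).1]
  · intro t ht t' ht' hne
    refine Finset.disjoint_left.2 fun τ h h' => ?_
    rw [Finset.mem_filter, Finset.mem_powersetCard] at h h'
    have hτ : τ.Nonempty := Finset.card_pos.1 (by omega)
    exact Set.disjoint_left.1 (hT.2.1 t ht t' ht' hne) (mem_tile.2 ⟨hτ, h.1.1, h.2⟩)
      (mem_tile.2 ⟨hτ, h'.1.1, h'.2⟩)

/-- The face numbers of `X` determine the `h`-vector up to its entry of index `0`, because a tile with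
`r` facets removed has one face with `r` vertices and no smaller faces. The empty simplex, which would
determine that entry, is not a face. -/
theorem IsTiling.tilingH_eq {V : Type} {n : ℕ} {X : Set (Finset V)}
    {T T' : Finset (Finset V × Finset V)} (hT : IsTiling n X T) (hT' : IsTiling n X T')
    (h0 : tilingH T 0 = tilingH T' 0) {k : ℕ} (hk : k ≤ n + 1) : tilingH T k = tilingH T' k := by
  induction k using Nat.strong_induction_on with
  | _ k ih =>
    rcases Nat.eq_zero_or_pos k with rfl | hpos
    · exact h0
    have h := (hT.ncard_faces hpos).symm.trans (hT'.ncard_faces hpos)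
    have hmem : k ∈ Finset.range (n + 2) := by rw [Finset.mem_range]; omega
    rw [← Finset.add_sum_erase _ _ hmem, ← Finset.add_sum_erase _ _ hmem] at h
    have hrest : ∀ r ∈ (Finset.range (n + 2)).erase k,
        (tilingH T r * if r ≤ k then (n + 1 - r).choose (k - r) else 0) =
          tilingH T' r * if r ≤ k then (n + 1 - r).choose (k - r) else 0 := by
      intro r hr
      split_ifs with hrk
      · rw [ih r (lt_of_le_of_ne hrk (Finset.ne_of_mem_erase hr)) (by omega)]
      · simp
    rw [Finset.sum_congr rfl hrest] at h
    simpa using h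

/-- The matrix `H_n`, computed from the tilings indexed by the permutations. -/
def tilingMatrix (n : ℕ) : Matrix (Fin (n + 2)) (Fin (n + 2)) ℕ :=
  fun s j => tilingH (permTiling n s) j

theorem isTilingMatrix_iff (n : ℕ) (H : Matrix (Fin (n + 2)) (Fin (n + 2)) ℕ) :
    IsTilingMatrix n H ↔ H = tilingMatrix n := by
  constructor
  · intro hH
    ext s j
    obtain ⟨T, hT, h0, -, hj⟩ := hH s
    rw [hj j]
    exact hT.tilingH_eq (isTiling_permTiling n s) (by rw [h0, tilingH_permTiling_zero])
      (by omega)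
  · rintro rfl s
    exact ⟨permTiling n s, isTiling_permTiling n s, tilingH_permTiling_zero n s,
      tilingH_permTiling_last (by omega), fun _ => rfl⟩

theorem sum_tilingMatrix (n : ℕ) (s : Fin (n + 2)) :
    ∑ j, tilingMatrix n s j = (n + 1).factorial := by
  have h := sum_tiling (isTiling_permTiling n s) fun _ => 1
  simp only [Finset.sum_const, smul_eq_mul, mul_one, card_permTiling] at h
  rw [h, ← Fin.sum_univ_eq_sum_range]
  rfl

/-- A vertex of `X` lies in a tile with at most one facet removed. The unique tile with no facet removed
for `s = 0` cannot contain both vertices `{0}` and `{1}` of `Sd(Δ_n)`. -/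
theorem tilingMatrix_pos {n : ℕ} (hn : 1 ≤ n) (s : Fin (n + 2)) :
    0 < tilingMatrix n s ⟨1, by omega⟩ := by
  classical
  rw [Nat.pos_iff_ne_zero]
  intro h1
  have h0 := tilingH_permTiling_zero n s
  have hT := isTiling_permTiling n s
  have h1 : tilingH (permTiling n s) 1 = 0 := h1
  rw [tilingH, Finset.card_eq_zero, Finset.filter_eq_empty_iff] at h1
  have hsing : ∀ A : Finset (Fin (n + 1)), {A} ∈ sdTile n s →
      ∃ t ∈ permTiling n s, t.2 = ∅ ∧ A ∈ t.1 := by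
    intro A hA
    rw [← hT.2.2] at hA
    simp only [Set.mem_iUnion, exists_prop] at hA
    obtain ⟨t, ht, hAt⟩ := hA
    obtain ⟨-, h2, h3⟩ := mem_tile.1 hAt
    refine ⟨t, ht, ?_, h2 (Finset.mem_singleton_self A)⟩
    rcases Finset.subset_singleton_iff.1 h3 with h | h
    · exact h
    · exact absurd (by rw [h, Finset.card_singleton]) (h1 ht)
  split_ifs at h0 with hs
  · have hmem : ∀ i : Fin (n + 1), {{i}} ∈ sdTile n s := fun i => by
      rw [mem_sdTile, hs]
      simp
    obtain ⟨t, ht, htR, hA⟩ := hsing _ (hmem 0)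
    obtain ⟨t', ht', htR', hA'⟩ := hsing _ (hmem ⟨1, by omega⟩)
    have heq : t = t' := by
      rw [tilingH] at h0
      exact Finset.card_le_one.1 h0.le t (Finset.mem_filter.2 ⟨ht, by rw [htR]; rfl⟩) t'
        (Finset.mem_filter.2 ⟨ht', by rw [htR']; rfl⟩)
    subst heq
    have hX : t.1 ∈ sdTile n s := by
      rw [← hT.2.2]
      exact Set.mem_biUnion ht (mem_tile.2 ⟨⟨_, hA⟩, subset_rfl, (hT.1 t ht).2⟩)
    rcases (mem_sdTile.1 hX).2.2.1.total hA hA' with h | h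
    · simp [Fin.ext_iff] at h
    · simp [Fin.ext_iff] at h
  · obtain ⟨t, ht, htR, -⟩ := hsing Finset.univ (mem_sdTile.2 (by simp))
    rw [tilingH, Finset.card_eq_zero, Finset.filter_eq_empty_iff] at h0
    exact h0 ht (by rw [htR]; rfl)

end HVector

/-! ### Stationary vectors of stochastic matrices with a positive column -/

section Stochastic

variable {ι : Type} [Fintype ι] {P : Matrix ι ι ℝ}

theorem sum_transpose_mulVec (hrow : ∀ i, ∑ j, P i j = 1) (x : ι → ℝ) :
    ∑ j, (P.transpose.mulVec x) j = ∑ i, x i := by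
  simp only [Matrix.mulVec, dotProduct, Matrix.transpose_apply]
  rw [Finset.sum_comm]
  simp only [← Finset.sum_mul, hrow, one_mul]

/-- Doeblin's contraction: on vectors of sum zero, `μ` can be subtracted from all entries of the
column `j₀` without changing the image. -/
theorem sum_abs_transpose_mulVec_le (h0 : ∀ i j, 0 ≤ P i j) (hrow : ∀ i, ∑ j, P i j = 1) {j₀ : ι}
    {μ : ℝ} (hμ : ∀ i, μ ≤ P i j₀) {x : ι → ℝ} (hx : ∑ i, x i = 0) :
    ∑ j, |(P.transpose.mulVec x) j| ≤ (1 - μ) * ∑ i, |x i| := by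
  classical
  have h1 : ∀ j, |(P.transpose.mulVec x) j| ≤
      ∑ i, (P i j - if j = j₀ then μ else 0) * |x i| := by
    intro j
    have h2 : (P.transpose.mulVec x) j = ∑ i, (P i j - if j = j₀ then μ else 0) * x i := by
      simp only [Matrix.mulVec, dotProduct, Matrix.transpose_apply, sub_mul,
        Finset.sum_sub_distrib, ← Finset.mul_sum, hx, mul_zero, sub_zero]
    rw [h2]
    refine (Finset.abs_sum_le_sum_abs _ _).trans (Finset.sum_le_sum fun i _ => ?_)
    rw [abs_mul, abs_of_nonneg]
    split_ifs with h
    · rw [h]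
      exact sub_nonneg.2 (hμ i)
    · simpa using h0 i j
  refine (Finset.sum_le_sum fun j _ => h1 j).trans (le_of_eq ?_)
  rw [Finset.sum_comm, Finset.mul_sum]
  refine Finset.sum_congr rfl fun i _ => ?_
  rw [← Finset.sum_mul, Finset.sum_sub_distrib, hrow]
  simp

theorem eq_zero_of_transpose_mulVec_eq (h0 : ∀ i j, 0 ≤ P i j) (hrow : ∀ i, ∑ j, P i j = 1)
    {j₀ : ι} {μ : ℝ} (hμ0 : 0 < μ) (hμ : ∀ i, μ ≤ P i j₀) {x : ι → ℝ} (hx : ∑ i, x i = 0)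
    (hfix : P.transpose.mulVec x = x) : x = 0 := by
  have h := sum_abs_transpose_mulVec_le h0 hrow hμ hx
  rw [hfix] at h
  have hnn : 0 ≤ ∑ i, |x i| := Finset.sum_nonneg fun i _ => abs_nonneg _
  have hz : ∑ i, |x i| = 0 := by nlinarith
  ext i
  exact abs_eq_zero.1 ((Finset.sum_eq_zero_iff_of_nonneg fun i _ => abs_nonneg _).1 hz i
    (Finset.mem_univ i))

theorem existsUnique_stationary (h0 : ∀ i j, 0 ≤ P i j) (hrow : ∀ i, ∑ j, P i j = 1)
    {j₀ : ι} {μ : ℝ} (hμ0 : 0 < μ) (hμ : ∀ i, μ ≤ P i j₀) :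
    ∃! h : ι → ℝ, P.transpose.mulVec h = h ∧ ∑ i, h i = 1 := by
  classical
  have hdet : (P.transpose - 1).det = 0 := by
    rw [← Matrix.transpose_one, ← Matrix.transpose_sub, Matrix.det_transpose,
      ← Matrix.exists_mulVec_eq_zero_iff]
    refine ⟨fun _ => 1, fun h => one_ne_zero (congrFun h j₀), ?_⟩
    rw [Matrix.sub_mulVec, Matrix.one_mulVec, sub_eq_zero]
    ext i
    simpa [Matrix.mulVec, dotProduct] using hrow i
  obtain ⟨v, hv0, hv⟩ := Matrix.exists_mulVec_eq_zero_iff.2 hdet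
  rw [Matrix.sub_mulVec, Matrix.one_mulVec, sub_eq_zero] at hv
  have hsum : ∑ i, v i ≠ 0 := fun h => hv0 (eq_zero_of_transpose_mulVec_eq h0 hrow hμ0 hμ h hv)
  refine ⟨(∑ i, v i)⁻¹ • v, ⟨?_, ?_⟩, ?_⟩
  · rw [Matrix.mulVec_smul, hv]
  · simp only [Pi.smul_apply, smul_eq_mul, ← Finset.mul_sum]
    exact inv_mul_cancel₀ hsum
  · rintro w ⟨hw, hw1⟩
    rw [← sub_eq_zero]
    refine eq_zero_of_transpose_mulVec_eq h0 hrow hμ0 hμ ?_ ?_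
    · simp only [Pi.sub_apply, Finset.sum_sub_distrib, hw1, Pi.smul_apply, smul_eq_mul,
        ← Finset.mul_sum, inv_mul_cancel₀ hsum, sub_self]
    · rw [Matrix.mulVec_sub, hw, Matrix.mulVec_smul, hv]

theorem tendsto_stationary (h0 : ∀ i j, 0 ≤ P i j) (hrow : ∀ i, ∑ j, P i j = 1)
    {j₀ : ι} {μ : ℝ} (hμ0 : 0 < μ) (hμ : ∀ i, μ ≤ P i j₀) {h : ι → ℝ}
    (hh : P.transpose.mulVec h = h) (hh1 : ∑ i, h i = 1) {v : ℕ → ι → ℝ}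
    (hv : ∀ d, v (d + 1) = P.transpose.mulVec (v d)) (hv0 : ∑ i, v 0 i = 1) (i : ι) :
    Tendsto (fun d => v d i) atTop (𝓝 (h i)) := by
  have hμ1 : μ ≤ 1 := by
    refine (hμ j₀).trans ?_
    rw [← hrow j₀]
    exact Finset.single_le_sum (fun j _ => h0 j₀ j) (Finset.mem_univ j₀)
  have hsum : ∀ d, ∑ i, v d i = 1 := by
    intro d
    induction d with
    | zero => exact hv0
    | succ d ih => rw [hv, sum_transpose_mulVec hrow, ih]
  have hbound : ∀ d, ∑ i, |v d i - h i| ≤ (1 - μ) ^ d * ∑ i, |v 0 i - h i| := by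
    intro d
    induction d with
    | zero => simp
    | succ d ih =>
      have h1 := sum_abs_transpose_mulVec_le h0 hrow hμ (x := v d - h)
        (by simp [Finset.sum_sub_distrib, hsum d, hh1])
      rw [Matrix.mulVec_sub, hh, ← hv] at h1
      simp only [Pi.sub_apply] at h1
      refine h1.trans ?_
      rw [pow_succ', mul_assoc]
      exact mul_le_mul_of_nonneg_left ih (sub_nonneg.2 hμ1)
  rw [tendsto_iff_dist_tendsto_zero]
  have hlim : Tendsto (fun d => (1 - μ) ^ d * ∑ i, |v 0 i - h i|) atTop (𝓝 0) := by
    have := (tendsto_pow_atTop_nhds_zero_of_lt_one (sub_nonneg.2 hμ1)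
      (by linarith : 1 - μ < 1)).mul_const (∑ i, |v 0 i - h i|)
    simpa using this
  refine squeeze_zero (fun d => dist_nonneg) (fun d => ?_) hlim
  rw [Real.dist_eq]
  exact (Finset.single_le_sum (f := fun i => |v d i - h i|) (fun i _ => abs_nonneg _)
    (Finset.mem_univ i)).trans (hbound d)

end Stochastic

/-- The stochastic matrix `H_n / (n + 1)!`. -/
noncomputable def transitionMatrix (n : ℕ) : Matrix (Fin (n + 2)) (Fin (n + 2)) ℝ :=
  fun s j => (tilingMatrix n s j : ℝ) / ((n + 1).factorial : ℝ)

theorem transitionMatrix_nonneg (n : ℕ) (s j : Fin (n + 2)) : 0 ≤ transitionMatrix n s j := by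
  unfold transitionMatrix
  positivity

theorem sum_transitionMatrix (n : ℕ) (s : Fin (n + 2)) : ∑ j, transitionMatrix n s j = 1 := by
  simp only [transitionMatrix, ← Finset.sum_div]
  rw [← Nat.cast_sum, sum_tilingMatrix, div_self]
  exact_mod_cast (n + 1).factorial_ne_zero

theorem le_transitionMatrix {n : ℕ} (hn : 1 ≤ n) (s : Fin (n + 2)) :
    1 / ((n + 1).factorial : ℝ) ≤ transitionMatrix n s ⟨1, by omega⟩ := by
  refine div_le_div_of_nonneg_right ?_ (Nat.cast_nonneg _)
  exact_mod_cast tilingMatrix_pos hn s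

theorem isAsymptoticHVector_iff {n : ℕ} {h : Fin (n + 2) → ℝ} :
    IsAsymptoticHVector n h ↔ (transitionMatrix n).transpose.mulVec h = h ∧ ∑ s, h s = 1 := by
  have hfac : ((n + 1).factorial : ℝ) ≠ 0 := by exact_mod_cast (n + 1).factorial_ne_zero
  have hmat : (tilingMatrix n).map (fun a : ℕ => (a : ℝ)) =
      ((n + 1).factorial : ℝ) • transitionMatrix n := by
    ext s j
    simp only [Matrix.map_apply, Matrix.smul_apply, transitionMatrix, smul_eq_mul]
    rw [mul_div_cancel₀ _ hfac]
  simp only [IsAsymptoticHVector, isTilingMatrix_iff, exists_eq_left, hmat, Matrix.transpose_smul,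
    Matrix.smul_mulVec]
  rw [smul_right_injective _ hfac |>.eq_iff]

theorem existsUnique_isAsymptoticHVector {n : ℕ} (hn : 1 ≤ n) :
    ∃! h : Fin (n + 2) → ℝ, IsAsymptoticHVector n h := by
  simp only [isAsymptoticHVector_iff]
  exact existsUnique_stationary (transitionMatrix_nonneg n) (sum_transitionMatrix n)
    (by positivity) (le_transitionMatrix hn)

/-! ### Subdividing the tiles of a tiling -/

section TilingOperations

variable {V W : Type} {n : ℕ}

theorem IsTiling.self_mem {X : Set (Finset V)} {T : Finset (Finset V × Finset V)}
    (hT : IsTiling n X T) {t : Finset V × Finset V} (ht : t ∈ T) : t.1 ∈ tile t.1 t.2 :=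
  mem_tile.2 ⟨Finset.card_pos.1 (by rw [(hT.1 t ht).1]; omega), subset_rfl, (hT.1 t ht).2⟩

theorem IsTiling.tile_subset {X : Set (Finset V)} {T : Finset (Finset V × Finset V)}
    (hT : IsTiling n X T) {t : Finset V × Finset V} (ht : t ∈ T) : tile t.1 t.2 ⊆ X := by
  rw [← hT.2.2]
  exact Set.subset_biUnion_of_mem (u := fun t => tile t.1 t.2) ht

theorem IsTiling.exists_mem {X : Set (Finset V)} {T : Finset (Finset V × Finset V)}
    (hT : IsTiling n X T) {τ : Finset V} (hτ : τ ∈ X) : ∃ t ∈ T, τ ∈ tile t.1 t.2 := by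
  rw [← hT.2.2] at hτ
  simpa only [Set.mem_iUnion, exists_prop] using hτ

theorem tile_map (e : V ↪ W) (σ R : Finset V) :
    tile (σ.map e) (R.map e) = Finset.map e '' tile σ R := by
  ext τ
  simp only [Set.mem_image, mem_tile]
  constructor
  · rintro ⟨h0, h1, h2⟩
    obtain ⟨ρ, hρ, rfl⟩ := Finset.subset_map_iff.1 h1
    exact ⟨ρ, ⟨by simpa using h0, hρ, by simpa using h2⟩, rfl⟩
  · rintro ⟨ρ, ⟨h0, h1, h2⟩, rfl⟩
    exact ⟨by simpa using h0, by simpa using h1, by simpa using h2⟩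

theorem IsTiling.exists_map {X : Set (Finset V)} {T : Finset (Finset V × Finset V)}
    (hT : IsTiling n X T) (e : V ↪ W) :
    ∃ T', IsTiling n (Finset.map e '' X) T' ∧ ∀ k, tilingH T' k = tilingH T k := by
  classical
  let E := (Finset.mapEmbedding e).toEmbedding
  refine ⟨T.map (E.prodMap E), ⟨?_, ?_, ?_⟩, fun k => ?_⟩
  · simp only [Finset.mem_map]
    rintro _ ⟨t, ht, rfl⟩
    exact ⟨by simpa [E] using (hT.1 t ht).1, by simpa [E] using (hT.1 t ht).2⟩
  · simp only [Finset.mem_map]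
    rintro _ ⟨t, ht, rfl⟩ _ ⟨t', ht', rfl⟩ hne
    change Disjoint (tile (t.1.map e) (t.2.map e)) (tile (t'.1.map e) (t'.2.map e))
    rw [tile_map, tile_map, Set.disjoint_image_iff (Finset.map_injective e)]
    exact hT.2.1 t ht t' ht' fun h => hne (by rw [h])
  · rw [← hT.2.2, Set.image_iUnion₂]
    ext τ
    simp only [Set.mem_iUnion, exists_prop, Finset.mem_map]
    constructor
    · rintro ⟨_, ⟨t, ht, rfl⟩, hτ⟩
      exact ⟨t, ht, by rw [← tile_map]; exact hτ⟩
    · rintro ⟨t, ht, hτ⟩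
      exact ⟨_, ⟨t, ht, rfl⟩, by rw [← tile_map] at hτ; exact hτ⟩
  · rw [tilingH, tilingH, Finset.filter_map, Finset.card_map]
    congr 1
    ext t
    rw [Finset.mem_filter, Finset.mem_filter]
    change _ ∧ (t.2.map e).card = k ↔ _
    rw [Finset.card_map]

theorem IsTiling.exists_biUnion {ι : Type} {X : Set (Finset V)} (I : Finset ι)
    (Y : ι → Set (Finset V)) (T : ι → Finset (Finset V × Finset V)) (hX : ⋃ i ∈ I, Y i = X)
    (hY : ∀ i ∈ I, ∀ j ∈ I, i ≠ j → Disjoint (Y i) (Y j)) (hT : ∀ i ∈ I, IsTiling n (Y i) (T i)) :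
    ∃ U, IsTiling n X U ∧ ∀ k, tilingH U k = ∑ i ∈ I, tilingH (T i) k := by
  classical
  refine ⟨I.biUnion T, ⟨?_, ?_, ?_⟩, fun k => ?_⟩
  · simp only [Finset.mem_biUnion]
    rintro t ⟨i, hi, ht⟩
    exact (hT i hi).1 t ht
  · simp only [Finset.mem_biUnion]
    rintro t ⟨i, hi, ht⟩ t' ⟨j, hj, ht'⟩ hne
    by_cases hij : i = j
    · subst hij
      exact (hT i hi).2.1 t ht t' ht' hne
    · exact (hY i hi j hj hij).mono ((hT i hi).tile_subset ht) ((hT j hj).tile_subset ht')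
  · rw [← hX]
    ext τ
    simp only [Set.mem_iUnion, Finset.mem_biUnion, exists_prop]
    constructor
    · rintro ⟨t, ⟨i, hi, ht⟩, hτ⟩
      exact ⟨i, hi, (hT i hi).tile_subset ht hτ⟩
    · rintro ⟨i, hi, hτ⟩
      obtain ⟨t, ht, hτt⟩ := (hT i hi).exists_mem hτ
      exact ⟨t, ⟨i, hi, ht⟩, hτt⟩
  · simp only [tilingH]
    rw [Finset.filter_biUnion, Finset.card_biUnion]
    intro i hi j hj hij
    refine Finset.disjoint_left.2 fun t ht ht' => ?_
    have ht := (Finset.mem_filter.1 ht).1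
    have ht' := (Finset.mem_filter.1 ht').1
    exact Set.disjoint_left.1 (hY i hi j hj hij) ((hT i hi).tile_subset ht ((hT i hi).self_mem ht))
      ((hT j hj).tile_subset ht' ((hT i hi).self_mem ht))

theorem exists_greatest_of_isChain {c : Finset (Finset V)} (hne : c.Nonempty)
    (hc : IsChain (fun σ τ : Finset V => σ ⊆ τ) (c : Set (Finset V))) :
    ∃ M ∈ c, ∀ A ∈ c, A ⊆ M := by
  obtain ⟨M, hM, hmax⟩ := c.exists_max_image Finset.card hne
  refine ⟨M, hM, fun A hA => ?_⟩
  rcases hc.total hA hM with h | h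
  · exact h
  · exact (Finset.eq_of_subset_of_card_le h (hmax A hA)).symm.subset

/-- The open simplices of the first barycentric subdivision of `tile σ R`: the chains of nonempty
faces of `σ` whose largest member contains `R`. -/
def sdOfTile (σ R : Finset V) : Set (Finset (Finset V)) :=
  {c | c.Nonempty ∧ (∀ A ∈ c, A.Nonempty ∧ A ⊆ σ) ∧
    IsChain (fun σ τ : Finset V => σ ⊆ τ) (c : Set (Finset V)) ∧ ∃ A ∈ c, R ⊆ A}

theorem exists_embedding_of_subset {σ R : Finset V} (hσ : σ.card = n + 1) (hR : R ⊆ σ) :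
    ∃ e : Fin (n + 1) ↪ V, Finset.univ.map e = σ ∧ ∀ i, e i ∈ R ↔ i.val < R.card := by
  classical
  let f : Fin (n + 1) ≃ σ := (σ.equivFinOfCardEq hσ).symm
  have hcard : Fintype.card {i : Fin (n + 1) // i.val < R.card} =
      Fintype.card {i : Fin (n + 1) // (f i).val ∈ R} := by
    have h1 : Fintype.card {i : Fin (n + 1) // (f i).val ∈ R} = R.card := by
      rw [← Fintype.card_coe R]
      refine Fintype.card_congr ⟨fun i => ⟨(f i.1).val, i.2⟩,
        fun x => ⟨f.symm ⟨x.1, hR x.2⟩, by simp⟩, fun i => by simp, fun x => by simp⟩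
    rw [h1, Fintype.card_subtype, Fin.card_filter_val_lt, min_eq_right]
    exact hσ ▸ Finset.card_le_card hR
  let g := (Fintype.equivOfCardEq hcard).extendSubtype
  let e : Fin (n + 1) ↪ V := (g.trans f).toEmbedding.trans (Function.Embedding.subtype _)
  have he : ∀ i, e i = (f (g i)).val := fun i => rfl
  refine ⟨e, ?_, fun i => ⟨fun h => ?_, fun h => ?_⟩⟩
  · refine Finset.eq_of_subset_of_card_le (fun x hx => ?_) (by simp [hσ])
    obtain ⟨i, -, rfl⟩ := Finset.mem_map.1 hx
    exact (f (g i)).2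
  · by_contra hcon
    exact Equiv.extendSubtype_not_mem (Fintype.equivOfCardEq hcard) i hcon h
  · exact Equiv.extendSubtype_mem (Fintype.equivOfCardEq hcard) i h

theorem mem_sdTile_iff_exists {s : ℕ} {c : Finset (Finset (Fin (n + 1)))} :
    c ∈ sdTile n s ↔ c.Nonempty ∧ (∀ A ∈ c, A.Nonempty) ∧
      IsChain (fun σ τ : Finset (Fin (n + 1)) => σ ⊆ τ) (c : Set (Finset (Fin (n + 1)))) ∧
      ∃ A ∈ c, ∀ i : Fin (n + 1), i.val < s → i ∈ A := by
  rw [mem_sdTile]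
  constructor
  · rintro ⟨h0, h1, h2, h3⟩
    obtain ⟨M, hM, hle⟩ := exists_greatest_of_isChain h0 h2
    refine ⟨h0, h1, h2, M, hM, fun i hi => ?_⟩
    obtain ⟨A, hA, hiA⟩ := h3 i hi
    exact hle A hA hiA
  · rintro ⟨h0, h1, h2, A, hA, h3⟩
    exact ⟨h0, h1, h2, fun i hi => ⟨A, hA, h3 i hi⟩⟩

theorem isChain_map_iff (e : V ↪ W) (c : Finset (Finset V)) :
    IsChain (fun σ τ : Finset W => σ ⊆ τ)
      (c.map (Finset.mapEmbedding e).toEmbedding : Set (Finset W)) ↔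
    IsChain (fun σ τ : Finset V => σ ⊆ τ) (c : Set (Finset V)) := by
  constructor
  · intro h A hA B hB hne
    have := h (x := A.map e) (by simpa using hA) (y := B.map e) (by simpa using hB)
      (by simpa using hne)
    simpa using this
  · intro h A hA B hB hne
    simp only [Finset.coe_map, Set.mem_image] at hA hB
    obtain ⟨A, hA, rfl⟩ := hA
    obtain ⟨B, hB, rfl⟩ := hB
    have := h hA hB fun h => hne (by rw [h])
    simpa using this

/-- The subdivision of a tile with `s` facets removed is a copy of `Sd(T_s^n)`, through a bijection from
`{0, …, n}` to `σ` carrying `{0, …, s - 1}` to `R`. -/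
theorem exists_sdOfTile_eq {σ R : Finset V} (hσ : σ.card = n + 1) (hR : R ⊆ σ) :
    ∃ e : Finset (Fin (n + 1)) ↪ Finset V, sdOfTile σ R = Finset.map e '' sdTile n R.card := by
  obtain ⟨e, he, heR⟩ := exists_embedding_of_subset hσ hR
  have hRsub : ∀ A : Finset (Fin (n + 1)), R ⊆ A.map e ↔ ∀ i, i.val < R.card → i ∈ A := by
    intro A
    constructor
    · intro h i hi
      simpa using h ((heR i).2 hi)
    · intro h x hx
      have hxσ := hR hx
      rw [← he] at hxσ
      obtain ⟨i, -, rfl⟩ := Finset.mem_map.1 hxσ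
      exact Finset.mem_map_of_mem e (h i ((heR i).1 hx))
  refine ⟨(Finset.mapEmbedding e).toEmbedding, ?_⟩
  ext c
  simp only [Set.mem_image, mem_sdTile_iff_exists]
  constructor
  · rintro ⟨h0, h1, h2, h3⟩
    have hsub : c ⊆ Finset.univ.map (Finset.mapEmbedding e).toEmbedding := by
      intro A hA
      have hAσ := (h1 A hA).2
      rw [← he] at hAσ
      obtain ⟨B, -, rfl⟩ := Finset.subset_map_iff.1 hAσ
      exact Finset.mem_map_of_mem _ (Finset.mem_univ B)
    obtain ⟨c, -, rfl⟩ := Finset.subset_map_iff.1 hsub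
    obtain ⟨A, hA, hRA⟩ := h3
    obtain ⟨A, hA', rfl⟩ := Finset.mem_map.1 hA
    refine ⟨c, ⟨by simpa using h0, fun A hA => ?_, (isChain_map_iff e c).1 h2, A, hA',
      (hRsub A).1 hRA⟩, rfl⟩
    have := (h1 _ (Finset.mem_map_of_mem _ hA)).1
    simpa using this
  · rintro ⟨c, ⟨h0, h1, h2, A, hA, h3⟩, rfl⟩
    refine ⟨by simpa using h0, fun A hA => ?_, (isChain_map_iff e c).2 h2, _,
      Finset.mem_map_of_mem _ hA, (hRsub A).2 h3⟩
    obtain ⟨A, hA', rfl⟩ := Finset.mem_map.1 hA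
    refine ⟨by simpa using h1 A hA', ?_⟩
    rw [← he]
    exact Finset.map_subset_map.2 (Finset.subset_univ A)

end TilingOperations

/-! ### Tilings of the interior of `Sd^d(Δ_n)` -/

section Interior

variable {n : ℕ}

theorem mem_interiorFaces_of_subset {d : ℕ} {A B : Finset (SdVertex (Fin (n + 1)) d)}
    (hA : A ∈ interiorFaces n d) (hAB : A ⊆ B) (hB : B ∈ (sdIter (stdSimplex n) d).faces) :
    B ∈ interiorFaces n d :=
  ⟨hB, fun h => hA.2 (((sdIter (stdBoundary n) d).isRelLowerSet_faces h).2 hAB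
    ((sdIter (stdSimplex n) d).isRelLowerSet_faces hA.1).1)⟩

theorem mem_interiorFaces_succ {d : ℕ} {c : Finset (Finset (SdVertex (Fin (n + 1)) d))} :
    c ∈ interiorFaces n (d + 1) ↔ c ∈ (sd (sdIter (stdSimplex n) d)).faces ∧
      ∃ A ∈ c, A ∈ interiorFaces n d := by
  constructor
  · rintro ⟨h1, h2⟩
    refine ⟨h1, ?_⟩
    by_contra! hcon
    refine h2 ⟨h1.1, fun A hA => ?_, h1.2.2⟩
    by_contra hA'
    exact hcon A hA ⟨h1.2.1 A hA, hA'⟩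
  · rintro ⟨h1, A, hA, hA'⟩
    exact ⟨h1, fun h => hA'.2 (h.2.1 A hA)⟩

theorem IsTiling.iUnion_sdOfTile {d : ℕ} {T : Finset (_ × _)}
    (hT : IsTiling n (interiorFaces n d) T) :
    ⋃ t ∈ T, sdOfTile t.1 t.2 = interiorFaces n (d + 1) := by
  ext c
  simp only [Set.mem_iUnion, exists_prop]
  constructor
  · rintro ⟨t, ht, h0, h1, h2, A, hA, hR⟩
    have hσ := (hT.tile_subset ht (hT.self_mem ht)).1
    exact mem_interiorFaces_succ.2 ⟨⟨h0, fun A hA =>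
      ((sdIter (stdSimplex n) d).isRelLowerSet_faces hσ).2 (h1 A hA).2 (h1 A hA).1, h2⟩, A, hA,
      hT.tile_subset ht (mem_tile.2 ⟨(h1 A hA).1, (h1 A hA).2, hR⟩)⟩
  · intro hc
    obtain ⟨⟨h0, h1, h2⟩, A, hA, hA'⟩ := mem_interiorFaces_succ.1 hc
    obtain ⟨M, hM, hle⟩ := exists_greatest_of_isChain h0 h2
    obtain ⟨t, ht, hMt⟩ := hT.exists_mem (mem_interiorFaces_of_subset hA' (hle A hA) (h1 M hM))
    obtain ⟨-, hMσ, hRM⟩ := mem_tile.1 hMt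
    exact ⟨t, ht, h0, fun B hB => ⟨((sdIter (stdSimplex n) d).isRelLowerSet_faces (h1 B hB)).1,
      (hle B hB).trans hMσ⟩, h2, M, hM, hRM⟩

theorem IsTiling.disjoint_sdOfTile {V : Type} {X : Set (Finset V)}
    {T : Finset (Finset V × Finset V)} (hT : IsTiling n X T) :
    ∀ t ∈ T, ∀ t' ∈ T, t ≠ t' → Disjoint (sdOfTile t.1 t.2) (sdOfTile t'.1 t'.2) := by
  intro t ht t' ht' hne
  refine Set.disjoint_left.2 ?_
  rintro c ⟨h0, h1, h2, A, hA, hR⟩ ⟨-, h1', -, A', hA', hR'⟩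
  obtain ⟨M, hM, hle⟩ := exists_greatest_of_isChain h0 h2
  exact Set.disjoint_left.1 (hT.2.1 t ht t' ht' hne)
    (mem_tile.2 ⟨(h1 M hM).1, (h1 M hM).2, hR.trans (hle A hA)⟩)
    (mem_tile.2 ⟨(h1 M hM).1, (h1' M hM).2, hR'.trans (hle A' hA')⟩)

theorem IsTiling.exists_subdivision {d : ℕ} {T : Finset (_ × _)}
    (hT : IsTiling n (interiorFaces n d) T) :
    ∃ T', IsTiling n (interiorFaces n (d + 1)) T' ∧ ∀ k, tilingH T' k =
      ∑ r ∈ Finset.range (n + 2), tilingH T r * tilingH (permTiling n r) k := by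
  have hex : ∀ t ∈ T, ∃ U, IsTiling n (sdOfTile t.1 t.2) U ∧
      ∀ k, tilingH U k = tilingH (permTiling n t.2.card) k := by
    intro t ht
    obtain ⟨e, he⟩ := exists_sdOfTile_eq (hT.1 t ht).1 (hT.1 t ht).2
    rw [he]
    exact (isTiling_permTiling n t.2.card).exists_map e
  choose! U hU hUh using hex
  obtain ⟨T', hT', hh⟩ := IsTiling.exists_biUnion T (fun t => sdOfTile t.1 t.2) U
    hT.iUnion_sdOfTile hT.disjoint_sdOfTile hU
  refine ⟨T', hT', fun k => (hh k).trans ?_⟩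
  rw [Finset.sum_congr rfl fun t ht => hUh t ht k]
  exact sum_tiling hT fun r => tilingH (permTiling n r) k

/-- Packings of the subdivided tiles give a packing of the interior of `Sd^{d+1}(Δ_n)`. -/
theorem IsTiling.exists_isPacking {d p : ℕ} {T : Finset (_ × _)}
    (hT : IsTiling n (interiorFaces n d) T) (w : ℕ → ℕ)
    (hw : ∀ s ≤ n + 1, ∃ S, IsPacking p (sdTile n s) S ∧ weight p S = w s) :
    ∃ S, IsPacking p (interiorFaces n (d + 1)) S ∧
      weight p S = ∑ r ∈ Finset.range (n + 2), tilingH T r * w r := by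
  have hex : ∀ t ∈ T, ∃ S, IsPacking p (sdOfTile t.1 t.2) S ∧ weight p S = w t.2.card := by
    intro t ht
    obtain ⟨e, he⟩ := exists_sdOfTile_eq (hT.1 t ht).1 (hT.1 t ht).2
    obtain ⟨S, hS, hSw⟩ := hw t.2.card
      ((Finset.card_le_card (hT.1 t ht).2).trans_eq (hT.1 t ht).1)
    rw [he]
    exact ⟨_, hS.map e, (weight_map p S e).trans hSw⟩
  choose! S hS hSw using hex
  have hsub : ∀ t ∈ T, sdOfTile t.1 t.2 ⊆ interiorFaces n (d + 1) := fun t ht c hc =>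
    hT.iUnion_sdOfTile.subset (Set.mem_biUnion ht hc)
  obtain ⟨U, hU, hUw⟩ := IsPacking.exists_biUnion T (fun t => sdOfTile t.1 t.2) S hsub
    hT.disjoint_sdOfTile hS
  refine ⟨U, hU, hUw.trans ?_⟩
  rw [Finset.sum_congr rfl hSw, sum_tiling hT w]
  rfl

theorem isTiling_singleton {V : Type} {σ : Finset V} (hσ : σ.card = n + 1) {X : Set (Finset V)}
    (hX : X = {σ}) : IsTiling n X {(σ, σ)} ∧ ∀ k, tilingH {(σ, σ)} k = if k = n + 1 then 1 else 0 := by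
  classical
  subst hX
  refine ⟨⟨?_, ?_, ?_⟩, fun k => ?_⟩
  · intro t ht
    rw [Finset.mem_singleton] at ht
    subst ht
    exact ⟨hσ, subset_rfl⟩
  · intro t ht t' ht' hne
    rw [Finset.mem_singleton] at ht ht'
    exact absurd (ht.trans ht'.symm) hne
  · ext τ
    simp only [Set.mem_iUnion, exists_prop, Finset.mem_singleton, exists_eq_left,
      Set.mem_singleton_iff]
    rw [mem_tile]
    constructor
    · rintro ⟨-, h1, h2⟩
      exact Finset.Subset.antisymm h1 h2
    · rintro rfl
      exact ⟨Finset.card_pos.1 (by omega), subset_rfl, subset_rfl⟩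
  · rw [tilingH, Finset.filter_singleton, hσ]
    split_ifs with h1 h2 h2
    · simp
    · exact absurd h1.symm h2
    · exact absurd h2.symm h1
    · simp

/-- The distribution of the numbers of removed facets in the iterated tiling of the interior of
`Sd^d(Δ_n)`. It starts from the open simplex `T_{n+1}^n`. -/
noncomputable def hVector (n : ℕ) : ℕ → Fin (n + 2) → ℝ
  | 0 => Pi.single (Fin.last (n + 1)) 1
  | d + 1 => (transitionMatrix n).transpose.mulVec (hVector n d)

theorem interiorFaces_zero (n : ℕ) :
    interiorFaces n 0 = {(Finset.univ : Finset (Fin (n + 1)))} := by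
  ext τ
  change Finset (Fin (n + 1)) at τ
  change (τ.Nonempty ∧ τ ⊆ Finset.univ) ∧ ¬ (τ.Nonempty ∧ τ ⊂ Finset.univ) ↔ τ = Finset.univ
  constructor
  · rintro ⟨⟨h0, h1⟩, h2⟩
    by_contra hne
    exact h2 ⟨h0, h1.ssubset_of_ne hne⟩
  · rintro rfl
    exact ⟨⟨Finset.univ_nonempty, subset_rfl⟩, fun h => h.2.ne rfl⟩

theorem exists_isTiling_interiorFaces (n d : ℕ) : ∃ T, IsTiling n (interiorFaces n d) T ∧
    ∀ k : Fin (n + 2), (tilingH T k : ℝ) = ((n + 1).factorial : ℝ) ^ d * hVector n d k := by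
  induction d with
  | zero =>
    obtain ⟨h1, h2⟩ := isTiling_singleton (n := n) (σ := (Finset.univ : Finset (Fin (n + 1))))
      (by simp) (interiorFaces_zero n)
    refine ⟨_, h1, fun k => ?_⟩
    rw [pow_zero, one_mul, hVector, Pi.single_apply]
    refine (congrArg Nat.cast (h2 k)).trans ?_
    simp only [Fin.ext_iff, Fin.val_last]
    split_ifs <;> simp
  | succ d ih =>
    obtain ⟨T, hT, hh⟩ := ih
    obtain ⟨T', hT', hh'⟩ := hT.exists_subdivision
    refine ⟨T', hT', fun k => ?_⟩
    have hfac : ((n + 1).factorial : ℝ) ≠ 0 := by exact_mod_cast (n + 1).factorial_ne_zero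
    rw [hh', ← Fin.sum_univ_eq_sum_range fun r => tilingH T r * tilingH (permTiling n r) k,
      hVector]
    push_cast
    simp only [Matrix.mulVec, dotProduct, Matrix.transpose_apply, transitionMatrix, hh,
      tilingMatrix, Finset.mul_sum]
    refine Finset.sum_congr rfl fun r _ => ?_
    field_simp
    ring

theorem sum_hVector (n d : ℕ) : ∑ k, hVector n d k = 1 := by
  induction d with
  | zero => simp [hVector]
  | succ d ih => rw [hVector, sum_transpose_mulVec (sum_transitionMatrix n), ih]

theorem card_tiling {n d : ℕ} {T : Finset (_ × _)} (hT : IsTiling n (interiorFaces n d) T)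
    (hh : ∀ k : Fin (n + 2), (tilingH T k : ℝ) = ((n + 1).factorial : ℝ) ^ d * hVector n d k) :
    (T.card : ℝ) = ((n + 1).factorial : ℝ) ^ d := by
  have h := sum_tiling hT fun _ => 1
  simp only [Finset.sum_const, smul_eq_mul, mul_one] at h
  rw [h, ← Fin.sum_univ_eq_sum_range]
  push_cast
  simp only [hh, ← Finset.mul_sum, sum_hVector, mul_one]

theorem weight_le_of_isPacking {n p d : ℕ} {S : Finset (Finset (SdVertex (Fin (n + 1)) d))}
    (hS : IsPacking p (interiorFaces n d) S) :
    (weight p S : ℝ) ≤ 2 ^ (n + 1) * (n.choose (p + 1) : ℝ) * ((n + 1).factorial : ℝ) ^ d := by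
  classical
  obtain ⟨T, hT, hh⟩ := exists_isTiling_interiorFaces n d
  have hsub : ∀ σ ∈ S, ∃ t ∈ T, σ ⊆ t.1 := by
    intro σ hσ
    obtain ⟨t, ht, h⟩ := hT.exists_mem (hS.mem σ hσ σ subset_rfl (hS.le_card σ hσ))
    exact ⟨t, ht, (mem_tile.1 h).2.1⟩
  have hcard : S.card ≤ T.card * 2 ^ (n + 1) := by
    have h1 : S ⊆ T.biUnion fun t => t.1.powerset := by
      intro σ hσ
      obtain ⟨t, ht, h⟩ := hsub σ hσ
      exact Finset.mem_biUnion.2 ⟨t, ht, Finset.mem_powerset.2 h⟩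
    refine (Finset.card_le_card h1).trans (Finset.card_biUnion_le_card_mul _ _ _ fun t ht => ?_)
    rw [Finset.card_powerset, (hT.1 t ht).1]
  have hw : weight p S ≤ S.card * n.choose (p + 1) := by
    refine Finset.sum_le_card_nsmul _ _ _ fun σ hσ => Nat.choose_le_choose _ ?_
    obtain ⟨t, ht, h⟩ := hsub σ hσ
    have := Finset.card_le_card h
    rw [(hT.1 t ht).1] at this
    omega
  have h2 : weight p S ≤ T.card * 2 ^ (n + 1) * n.choose (p + 1) :=
    hw.trans (Nat.mul_le_mul_right _ hcard)
  calc (weight p S : ℝ) ≤ ((T.card * 2 ^ (n + 1) * n.choose (p + 1) : ℕ) : ℝ) := by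
        exact_mod_cast h2
    _ = _ := by
        push_cast
        rw [card_tiling hT hh]
        ring

end Interior

/-! ### Copies of `Sd^d(Δ_n)` in `Sd^{d+1}(Δ_n)` -/

section SelfSimilarity

variable {n : ℕ}

/-- The map on vertices of `d`-th subdivisions induced by a map from the vertices of a complex to those
of a first subdivision. The shift of the index of `SdVertex` expresses `Sd^d ∘ Sd = Sd^{d+1}`. -/
def liftVertex {V W : Type} (e : V ↪ Finset W) : (d : ℕ) → SdVertex V d ↪ SdVertex W (d + 1)
  | 0 => e
  | d + 1 => (Finset.mapEmbedding (liftVertex e d)).toEmbedding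

/-- The identification of `Δ_n` with the `n`-simplex of `Sd(Δ_n)` given by the flag of `π`. -/
def prefixEmbedding (π : Equiv.Perm (Fin (n + 1))) : Fin (n + 1) ↪ Finset (Fin (n + 1)) :=
  ⟨prefixSet π, prefixSet_injective π⟩

theorem map_mem_sd_faces {V W : Type} {K : PreAbstractSimplicialComplex V}
    {K' : PreAbstractSimplicialComplex W} (e : V ↪ W)
    (he : ∀ A ∈ K.faces, A.map e ∈ K'.faces) {c : Finset (Finset V)} (hc : c ∈ (sd K).faces) :
    c.map (Finset.mapEmbedding e).toEmbedding ∈ (sd K').faces := by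
  obtain ⟨h0, h1, h2⟩ := hc
  refine ⟨by simpa using h0, fun A hA => ?_, (isChain_map_iff e c).2 h2⟩
  obtain ⟨A, hA', rfl⟩ := Finset.mem_map.1 hA
  exact he A (h1 A hA')

theorem map_liftVertex_mem (π : Equiv.Perm (Fin (n + 1))) (d : ℕ) :
    ∀ c ∈ (sdIter (stdSimplex n) d).faces,
      c.map (liftVertex (prefixEmbedding π) d) ∈ (sdIter (stdSimplex n) (d + 1)).faces := by
  induction d with
  | zero =>
    intro c hc
    change Finset (Fin (n + 1)) at c
    have hsub : c.map (prefixEmbedding π) ⊆ permFlag π := by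
      intro A hA
      obtain ⟨i, -, rfl⟩ := Finset.mem_map.1 hA
      exact Finset.mem_image_of_mem _ (Finset.mem_univ i)
    have hX := mem_sdTile_of_subset_permFlag (s := 0) (Finset.card_pos.1 (by
      rw [card_permFlag]; omega)) (subset_refl (permFlag π)) (restriction_subset 0 π)
    exact ((sd (stdSimplex n)).isRelLowerSet_faces hX.1).2 hsub ((Finset.map_nonempty).2 hc.1)
  | succ d ih => exact fun c hc => map_mem_sd_faces _ ih hc

theorem mem_boundary_of_map_liftVertex_mem (π : Equiv.Perm (Fin (n + 1))) (d : ℕ) :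
    ∀ c ∈ (sdIter (stdSimplex n) d).faces,
      c.map (liftVertex (prefixEmbedding π) d) ∈ (sdIter (stdBoundary n) (d + 1)).faces →
      c ∈ (sdIter (stdBoundary n) d).faces := by
  induction d with
  | zero =>
    intro c hc hb
    change Finset (Fin (n + 1)) at c
    refine ⟨hc.1, (Finset.subset_univ c).ssubset_of_ne ?_⟩
    rintro rfl
    have hmem : prefixSet π (Fin.last n) ∈ Finset.univ.map (prefixEmbedding π) :=
      Finset.mem_map_of_mem (prefixEmbedding π) (Finset.mem_univ (Fin.last n))
    refine (hb.2.1 _ hmem).2.ne (Finset.eq_univ_iff_forall.2 fun x => ?_)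
    exact mem_prefixSet.2 (Fin.le_last _)
  | succ d ih =>
    intro c hc hb
    exact ⟨hc.1, fun A hA => ih A (hc.2.1 A hA) (hb.2.1 _ (Finset.mem_map_of_mem _ hA)), hc.2.2⟩

/-- The copies of `Sd^d(Δ_n)` in two different `n`-simplices of `Sd(Δ_n)` meet only along the
subdivided boundary. -/
theorem mem_boundary_of_map_liftVertex_eq {π π' : Equiv.Perm (Fin (n + 1))} (hne : π ≠ π')
    (d : ℕ) : ∀ c ∈ (sdIter (stdSimplex n) d).faces,
      ∀ c' : Finset (SdVertex (Fin (n + 1)) d),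
        c.map (liftVertex (prefixEmbedding π) d) = c'.map (liftVertex (prefixEmbedding π') d) →
      c ∈ (sdIter (stdBoundary n) d).faces := by
  induction d with
  | zero =>
    intro c hc c' hcc'
    change Finset (Fin (n + 1)) at c c'
    refine ⟨hc.1, (Finset.subset_univ c).ssubset_of_ne ?_⟩
    rintro rfl
    refine hne (permFlag_injective (Finset.eq_of_subset_of_card_le ?_ ?_))
    · intro A hA
      obtain ⟨i, -, rfl⟩ := Finset.mem_image.1 hA
      have hmem : prefixSet π i ∈ Finset.univ.map (prefixEmbedding π) :=
        Finset.mem_map_of_mem (prefixEmbedding π) (Finset.mem_univ i)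
      have hmem' : prefixSet π i ∈ c'.map (prefixEmbedding π') :=
        (congrArg (prefixSet π i ∈ ·) hcc').mp hmem
      obtain ⟨j, -, hj⟩ := Finset.mem_map.1 hmem'
      rw [← hj]
      exact Finset.mem_image_of_mem _ (Finset.mem_univ j)
    · rw [card_permFlag, card_permFlag]
  | succ d ih =>
    intro c hc c' hcc'
    refine ⟨hc.1, fun A hA => ?_, hc.2.2⟩
    have hmem : A.map (liftVertex (prefixEmbedding π) d) ∈
        Finset.map (liftVertex (prefixEmbedding π) (d + 1)) c := Finset.mem_map_of_mem _ hA
    rw [hcc'] at hmem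
    obtain ⟨A', -, hA'⟩ := Finset.mem_map.1 hmem
    exact ih A (hc.2.1 A hA) A' hA'.symm

theorem IsPacking.exists_succ {p d : ℕ} {S : Finset (Finset (SdVertex (Fin (n + 1)) d))}
    (hS : IsPacking p (interiorFaces n d) S) :
    ∃ S', IsPacking p (interiorFaces n (d + 1)) S' ∧
      weight p S' = (n + 1).factorial * weight p S := by
  obtain ⟨U, hU, hUw⟩ := IsPacking.exists_biUnion (p := p) (X := interiorFaces n (d + 1))
    (Finset.univ : Finset (Equiv.Perm (Fin (n + 1))))
    (fun π => Finset.map (liftVertex (prefixEmbedding π) d) '' interiorFaces n d)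
    (fun π => S.map (Finset.mapEmbedding (liftVertex (prefixEmbedding π) d)).toEmbedding)
    (by
      rintro π - _ ⟨c, hc, rfl⟩
      exact ⟨map_liftVertex_mem π d c hc.1,
        fun h => hc.2 (mem_boundary_of_map_liftVertex_mem π d c hc.1 h)⟩)
    (by
      intro π _ π' _ hne
      refine Set.disjoint_left.2 ?_
      rintro _ ⟨c, hc, rfl⟩ ⟨c', -, hcc'⟩
      exact hc.2 (mem_boundary_of_map_liftVertex_eq hne d c hc.1 c' hcc'.symm))
    (fun π _ => hS.map _)
  refine ⟨U, hU, hUw.trans ?_⟩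
  simp only [weight_map, Finset.sum_const, smul_eq_mul, Finset.card_univ, Fintype.card_perm,
    Fintype.card_fin]

end SelfSimilarity

/-! ### The packing density and its limit -/

section Density

variable {n p : ℕ} {ν : ℝ}

theorem morse_coeff_nonneg (p : ℕ) (hν : ν ∈ Set.Icc (0 : ℝ) 1) :
    0 ≤ ν * (1 - ν) * (ν ^ p + (1 - ν) ^ p) := by
  have h0 := hν.1
  have h1 : 0 ≤ 1 - ν := sub_nonneg.2 hν.2
  positivity

theorem le_packingDensity (hp : 1 ≤ p) {d : ℕ} {S : Finset (Finset (SdVertex (Fin (n + 1)) d))}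
    (hS : IsPacking p (interiorFaces n d) S) :
    ν * (1 - ν) * (ν ^ p + (1 - ν) ^ p) * (weight p S : ℝ) / ((n + 1).factorial : ℝ) ^ d ≤
      packingDensity n p ν d := by
  obtain ⟨L, hL, hM⟩ := exists_mem_packings_of_isPacking hp ν hS
  rw [packingDensity, one_div, div_eq_inv_mul, ← hM]
  refine mul_le_mul_of_nonneg_left ?_ (by positivity)
  exact le_csSup ((packings_finite n p d).image _).bddAbove (Set.mem_image_of_mem _ hL)

theorem exists_packingDensity_eq (hp : 1 ≤ p) (n d : ℕ) (ν : ℝ) :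
    ∃ S, IsPacking p (interiorFaces n d) S ∧ packingDensity n p ν d =
      ν * (1 - ν) * (ν ^ p + (1 - ν) ^ p) * (weight p S : ℝ) / ((n + 1).factorial : ℝ) ^ d := by
  obtain ⟨L, hL, hM⟩ := ((packings_nonempty n p d).image (morseNumber p ν)).csSup_mem
    ((packings_finite n p d).image _)
  obtain ⟨S, hS, hSM⟩ := exists_isPacking_of_mem_packings hp ν hL
  exact ⟨S, hS, by rw [packingDensity, ← hM, hSM, one_div, div_eq_inv_mul]⟩

theorem packingDensity_monotone (hp : 1 ≤ p) : Monotone (packingDensity n p ν) := by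
  refine monotone_nat_of_le_succ fun d => ?_
  obtain ⟨S, hS, hd⟩ := exists_packingDensity_eq hp n d ν
  obtain ⟨S', hS', hw⟩ := hS.exists_succ
  refine le_trans (le_of_eq ?_) (le_packingDensity hp hS')
  have hfac : ((n + 1).factorial : ℝ) ≠ 0 := by exact_mod_cast (n + 1).factorial_ne_zero
  rw [hd, hw]
  push_cast
  field_simp
  ring

theorem packingDensity_le (hp : 1 ≤ p) (hν : ν ∈ Set.Icc (0 : ℝ) 1) (d : ℕ) :
    packingDensity n p ν d ≤
      ν * (1 - ν) * (ν ^ p + (1 - ν) ^ p) * (2 ^ (n + 1) * (n.choose (p + 1) : ℝ)) := by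
  obtain ⟨S, hS, hd⟩ := exists_packingDensity_eq hp n d ν
  have hfac : (0 : ℝ) < ((n + 1).factorial : ℝ) ^ d := by positivity
  rw [hd, div_le_iff₀ hfac, mul_assoc _ _ (((n + 1).factorial : ℝ) ^ d)]
  exact mul_le_mul_of_nonneg_left (weight_le_of_isPacking hS) (morse_coeff_nonneg p hν)

theorem exists_tendsto_packingDensity (n : ℕ) (hp : 1 ≤ p) (hν : ν ∈ Set.Icc (0 : ℝ) 1) :
    ∃ lam : ℝ, Tendsto (packingDensity n p ν) atTop (𝓝 lam) :=
  ⟨_, tendsto_atTop_ciSup (packingDensity_monotone hp)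
    ⟨_, Set.forall_mem_range.2 (packingDensity_le hp hν)⟩⟩

/-- The weight of the packing of `Sd(T_s^n)` by the truncated flags: the first term comes from the empty
set of gaps, the others from the sets of gaps with maximum `v`. -/
def tileWeight (n p s : ℕ) : ℕ :=
  (min n (n + p - s)).choose (p + 1) +
    ∑ v ∈ Finset.Ico s (n + 1), 2 ^ (v - s) * (min n (n + p - (v + 2))).choose (p + 1)

theorem le_packingDensity_succ (hp : 1 ≤ p) (d : ℕ) :
    ν * (1 - ν) * (ν ^ p + (1 - ν) ^ p) / ((n + 1).factorial : ℝ) *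
      ∑ r : Fin (n + 2), hVector n d r * (tileWeight n p r : ℝ) ≤ packingDensity n p ν (d + 1) := by
  obtain ⟨T, hT, hh⟩ := exists_isTiling_interiorFaces n d
  obtain ⟨S, hS, hw⟩ := hT.exists_isPacking (tileWeight n p)
    fun s hs => exists_isPacking_sdTile hp hs
  refine le_trans (le_of_eq ?_) (le_packingDensity hp hS)
  have hfac : ((n + 1).factorial : ℝ) ≠ 0 := by exact_mod_cast (n + 1).factorial_ne_zero
  rw [hw, ← Fin.sum_univ_eq_sum_range fun r => tilingH T r * tileWeight n p r]
  push_cast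
  simp only [hh, mul_assoc, ← Finset.mul_sum]
  field_simp
  ring

theorem le_of_tendsto_packingDensity (hn : 1 ≤ n) (hp : 1 ≤ p) {lam : ℝ}
    {h : Fin (n + 2) → ℝ} (hlam : Tendsto (packingDensity n p ν) atTop (𝓝 lam))
    (hh : IsAsymptoticHVector n h) :
    ν * (1 - ν) * (ν ^ p + (1 - ν) ^ p) / ((n + 1).factorial : ℝ) *
      ∑ r : Fin (n + 2), h r * (tileWeight n p r : ℝ) ≤ lam := by
  obtain ⟨hfix, hsum⟩ := isAsymptoticHVector_iff.1 hh
  have hlim : ∀ r, Tendsto (fun d => hVector n d r) atTop (𝓝 (h r)) :=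
    tendsto_stationary (transitionMatrix_nonneg n) (sum_transitionMatrix n)
      (by positivity) (le_transitionMatrix hn) hfix hsum (fun d => rfl) (sum_hVector n 0)
  exact le_of_tendsto_of_tendsto'
    ((tendsto_finsetSum _ fun r _ => (hlim r).mul_const _).const_mul _)
    (hlam.comp (tendsto_add_atTop_nat 1)) (le_packingDensity_succ hp)

end Density

/-! ### The closed form of the bound -/

section Arithmetic

variable {n p : ℕ}

/-- The substitution `j = v + 2`; the term `v = n`, of simplices of dimension at most `p - 2`, is
zero. -/
theorem tileWeight_eq_sum_Ico (hp : 1 ≤ p) {r : ℕ} (hr : r ≤ n + 1) :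
    tileWeight n p r = (min n (n + p - r)).choose (p + 1) +
      ∑ j ∈ Finset.Ico (r + 2) (n + 2), 2 ^ (j - 2 - r) * (min n (n + p - j)).choose (p + 1) := by
  have h := Finset.sum_Ico_add' (fun j => 2 ^ (j - 2 - r) *
    (min n (n + p - j)).choose (p + 1)) r (n + 1) 2
  simp only [Nat.add_sub_cancel] at h
  rw [tileWeight, h]
  rcases Nat.lt_or_ge n r with hnr | hnr
  · rw [Finset.Ico_eq_empty (by omega), Finset.Ico_eq_empty (by omega)]
  · have hz : (min n (n + p - (n + 2))).choose (p + 1) = 0 :=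
      Nat.choose_eq_zero_of_lt (lt_of_le_of_lt (min_le_right _ _) (by omega))
    rw [show n + 1 + 2 = n + 2 + 1 by omega, Finset.sum_Ico_succ_top (by omega), hz, mul_zero,
      add_zero]

/-- For `r < p` the simplices of the sum with `j ≤ p` have dimension `n`; together with the one in the
first term they number `1 + (1 + 2 + ⋯ + 2 ^ (p - 2 - r)) = 2 ^ (p - 1 - r)`. -/
theorem tileWeight_eq (hp : 1 ≤ p) {r : ℕ} (hr : r ≤ n + 1) :
    tileWeight n p r = (if r = p then 1 else 0) * n.choose (p + 1) +
      (if r ≤ p - 1 then 2 ^ (p - 1 - r) else 0) * n.choose (p + 1) +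
      (if p + 1 ≤ r then (n + p - r).choose (p + 1) else 0) +
      ∑ j ∈ Finset.range (n + 2), if p + 1 ≤ j then
        (if r ≤ j - 2 then 2 ^ (j - 2 - r) else 0) * (n + p - j).choose (p + 1) else 0 := by
  have hmin : ∀ j, p ≤ j → min n (n + p - j) = n + p - j := fun j hj => min_eq_right (by omega)
  have hmin' : ∀ j, j ≤ p → min n (n + p - j) = n := fun j hj => min_eq_left (by omega)
  have hsum : ∀ a, p + 1 ≤ a → r + 2 ≤ a → (∀ j, p + 1 ≤ j → r ≤ j - 2 → a ≤ j) →
      (∑ j ∈ Finset.range (n + 2), if p + 1 ≤ j then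
        (if r ≤ j - 2 then 2 ^ (j - 2 - r) else 0) * (n + p - j).choose (p + 1) else 0) =
      ∑ j ∈ Finset.Ico a (n + 2), 2 ^ (j - 2 - r) * (min n (n + p - j)).choose (p + 1) := by
    intro a h1 h2 h3
    symm
    refine Finset.sum_subset_zero_on_sdiff (fun j hj => ?_) (fun j hj => ?_) (fun j hj => ?_)
    · exact Finset.mem_range.2 (Finset.mem_Ico.1 hj).2
    · rw [Finset.mem_sdiff, Finset.mem_range, Finset.mem_Ico] at hj
      split_ifs with h4 h5
      · exact absurd ⟨h3 j h4 h5, hj.1⟩ hj.2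
      · simp
      · rfl
    · rw [Finset.mem_Ico] at hj
      rw [if_pos (by omega), if_pos (by omega), hmin j (by omega)]
  rw [tileWeight_eq_sum_Ico hp hr]
  rcases lt_trichotomy r p with h | h | h
  · rw [hsum (p + 1) le_rfl (by omega) (fun _ h _ => h), if_neg (by omega), if_pos (by omega),
      if_neg (by omega), hmin' r h.le]
    rcases le_total p (n + 1) with hpn | hpn
    · rw [← Finset.sum_Ico_consecutive _ (show r + 2 ≤ p + 1 by omega) (by omega)]
      have : ∑ j ∈ Finset.Ico (r + 2) (p + 1), 2 ^ (j - 2 - r) *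
          (min n (n + p - j)).choose (p + 1) =
          (∑ k ∈ Finset.range (p - 1 - r), 2 ^ k) * n.choose (p + 1) := by
        rw [Finset.sum_mul, Finset.sum_Ico_eq_sum_range,
          show p + 1 - (r + 2) = p - 1 - r by omega]
        refine Finset.sum_congr rfl fun k hk => ?_
        rw [Finset.mem_range] at hk
        rw [hmin' _ (by omega), show r + 2 + k - 2 - r = k by omega]
      have hgeom := Nat.geomSum_eq (m := 2) le_rfl (p - 1 - r)
      have hpos := Nat.one_le_two_pow (n := p - 1 - r)
      rw [this]
      obtain ⟨q, hq⟩ := Nat.exists_eq_add_of_le hpos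
      rw [hgeom, hq]
      simp only [Nat.add_sub_cancel_left, Nat.reduceSub, Nat.div_one]
      ring
    · rw [Finset.Ico_eq_empty (a := p + 1) (by omega), Finset.sum_empty,
        Nat.choose_eq_zero_of_lt (show n < p + 1 by omega), Finset.sum_eq_zero]
      · simp
      · intro j hj
        rw [Nat.choose_eq_zero_of_lt (lt_of_le_of_lt (min_le_left _ _) (by omega)), mul_zero]
  · subst h
    rw [hsum (r + 2) (by omega) le_rfl (by omega), if_pos rfl, if_neg (by omega),
      if_neg (by omega), hmin' r le_rfl]
    ring
  · rw [hsum (r + 2) (by omega) le_rfl (by omega), if_neg (by omega), if_neg (by omega),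
      if_pos (by omega), hmin r h.le]
    ring

theorem sum_mul_tileWeight (hp : 1 ≤ p) (hpn : p ≤ n + 1) (h : Fin (n + 2) → ℝ) :
    ∑ r : Fin (n + 2), h r * (tileWeight n p r : ℝ) =
      (h ⟨p, by omega⟩ +
            2 ^ (p - 1) * ∑ i : Fin (n + 2) with i.val ≤ p - 1, h i / 2 ^ i.val) *
            (n.choose (p + 1) : ℝ) +
          ∑ j : Fin (n + 2) with p + 1 ≤ j.val,
            (h j + 2 ^ (j.val - 2) *
                ∑ i : Fin (n + 2) with i.val ≤ j.val - 2, h i / 2 ^ i.val) *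
              ((n + p - j.val).choose (p + 1) : ℝ) := by
  have hpow : ∀ a r : ℕ, (2 : ℝ) ^ a * (if r ≤ a then (1 : ℝ) / 2 ^ r else 0) =
      if r ≤ a then 2 ^ (a - r) else 0 := by
    intro a r
    split_ifs with hra
    · rw [mul_one_div, pow_sub₀ _ two_ne_zero hra, div_eq_mul_inv]
    · simp
  have hinner : ∀ a : ℕ, (2 : ℝ) ^ a * ∑ i : Fin (n + 2) with i.val ≤ a, h i / 2 ^ i.val =
      ∑ i : Fin (n + 2), h i * if i.val ≤ a then 2 ^ (a - i.val) else 0 := by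
    intro a
    rw [Finset.sum_filter, Finset.mul_sum]
    refine Finset.sum_congr rfl fun i _ => ?_
    rw [← hpow]
    split_ifs <;> ring
  have hsingle : h ⟨p, by omega⟩ = ∑ i : Fin (n + 2), h i * if i.val = p then 1 else 0 := by
    rw [Finset.sum_eq_single ⟨p, by omega⟩]
    · simp
    · intro i _ hi
      rw [if_neg fun h => hi (Fin.ext h), mul_zero]
    · simp
  simp only [hinner]
  rw [hsingle, ← Finset.sum_add_distrib, Finset.sum_mul, Finset.sum_filter]
  have hsplit : ∀ j : Fin (n + 2), (if p + 1 ≤ j.val then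
      (h j + ∑ i : Fin (n + 2), h i * if i.val ≤ j.val - 2 then 2 ^ (j.val - 2 - i.val) else 0) *
        ((n + p - j.val).choose (p + 1) : ℝ) else 0) =
      h j * (if p + 1 ≤ j.val then ((n + p - j.val).choose (p + 1) : ℝ) else 0) +
      ∑ i : Fin (n + 2), h i * (if p + 1 ≤ j.val then
        (if i.val ≤ j.val - 2 then 2 ^ (j.val - 2 - i.val) else 0) *
          ((n + p - j.val).choose (p + 1) : ℝ) else 0) := by
    intro j
    split_ifs
    · rw [add_mul, Finset.sum_mul]
      simp only [mul_assoc]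
    · simp
  rw [Finset.sum_congr rfl fun j _ => hsplit j, Finset.sum_add_distrib, Finset.sum_comm,
    ← Finset.sum_add_distrib, ← Finset.sum_add_distrib]
  refine Finset.sum_congr rfl fun r _ => ?_
  rw [tileWeight_eq hp (by omega), ← Fin.sum_univ_eq_sum_range fun j => if p + 1 ≤ j then
        (if r.val ≤ j - 2 then 2 ^ (j - 2 - r.val) else 0) * (n + p - j).choose (p + 1) else 0]
  push_cast
  rw [← Finset.mul_sum]
  ring

end Arithmetic

end TilingPacking

theorem theorem1p10 (n p : ℕ) (hn : 2 ≤ n) (hp : 1 ≤ p) (hpn : p ≤ n - 1)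
    (ν : ℝ) (hν : ν ∈ Set.Icc (0 : ℝ) 1) :
    (∃ lam : ℝ, Tendsto (TilingPacking.packingDensity n p ν) atTop (𝓝 lam)) ∧
    (∃! h : Fin (n + 2) → ℝ, TilingPacking.IsAsymptoticHVector n h) ∧
    ∀ (lam : ℝ) (h : Fin (n + 2) → ℝ),
      Tendsto (TilingPacking.packingDensity n p ν) atTop (𝓝 lam) →
      TilingPacking.IsAsymptoticHVector n h →
      lam ≥ (ν * (1 - ν) * (ν ^ p + (1 - ν) ^ p)) / ((n + 1).factorial : ℝ) *
        ((h ⟨p, by omega⟩ +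
            2 ^ (p - 1) * ∑ i : Fin (n + 2) with i.val ≤ p - 1, h i / 2 ^ i.val) *
            (n.choose (p + 1) : ℝ) +
          ∑ j : Fin (n + 2) with p + 1 ≤ j.val,
            (h j + 2 ^ (j.val - 2) *
                ∑ i : Fin (n + 2) with i.val ≤ j.val - 2, h i / 2 ^ i.val) *
              ((n + p - j.val).choose (p + 1) : ℝ)) := by
  refine ⟨TilingPacking.exists_tendsto_packingDensity n hp hν,
    TilingPacking.existsUnique_isAsymptoticHVector (by omega), fun lam h hlam hh => ?_⟩
  rw [ge_iff_le, ← TilingPacking.sum_mul_tileWeight hp (by omega) h]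
  exact TilingPacking.le_of_tendsto_packingDensity (by omega) hp hlam hh
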